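/- An orientation of a finite simple graph $G$ is *sink-free* if every vertex has at least one outgoing edge; let $\mathrm{sfo}(G)$ denote the number of sink-free orientations of $G$. **Theorem.** There is a deterministic algorithm that, on input of a non-empty finite simple graph $G$ with $n$ vertices, $m$ edges and minimum degree at least $3$, given by adjacency lists, and of a rational number $\varepsilon=p/q>0$ (with positive integers $p,q$), computes the number $\mathrm{sfo}(G)$ within a multiplicative factor $\exp(\varepsilon)$: it outputs integers $a,b$ with $$e^{-\varepsilon}\,\mathrm{sfo}(G)\;\le\; a\,2^{b}\;\le\; e^{\varepsilon}\,\mathrm{sfo}(G).$$ Its running time is at most $C\,n\,\max(1,m/\varepsilon)^{7}$, where $C$ is an absolute constant; in particular it is $O\bigl(n(m/\varepsilon)^{7}\bigr)$ for $\varepsilon\le m$. Here the algorithm is a single program for a word random access machine: the input is stored in memory as the words $n,p,q$, the $n+1$ addresses that delimit the adjacency lists, and the adjacency lists, each in arbitrary order; each elementary operation on words (integer addition, subtraction, multiplication, division, reading or writing a memory cell, test, subroutine call) takes one step; and all numbers computed are bounded in absolute value by $(n+p+q)^{c}$ for an absolute constant $c$, i.e. words have $O(\log(n+p+q))$ bits.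 -/

import Mathlib

/-! ### A deterministic word random access machine

A machine has registers and a random access memory, both holding integers.  A program is a finite
list of procedures, which use conditionals, loops and (possibly recursive) calls without arguments.
The machine is run with a word bound `W`: it gets stuck as soon as it computes a number of absolute
value larger than `W`.  Every elementary operation, test, call and sequencing takes one step. -/

namespace WordRAM

/-- The arithmetic operations.  Division is Euclidean division of integers, with `x / 0 = 0`. -/
inductive Op where
  | add | sub | mul | div

def Op.eval : Op → ℤ → ℤ → ℤ
  | .add, x, y => x + y
  | .sub, x, y => x - y
  | .mul, x, y => x * y
  | .div, x, y => x / y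

/-- Commands.  Registers and procedures are referred to by natural numbers. -/
inductive Cmd where
  /-- do nothing -/
  | skip
  /-- `r := z` -/
  | const (r : ℕ) (z : ℤ)
  /-- `r := x op y`, where `x` and `y` are registers -/
  | arith (op : Op) (r x y : ℕ)
  /-- `r := memory[x]` -/
  | load (r x : ℕ)
  /-- `memory[x] := r` -/
  | store (x r : ℕ)
  /-- first `c`, then `d` -/
  | seq (c d : Cmd)
  /-- if register `x` is positive then `c`, else `d` -/
  | ifPos (x : ℕ) (c d : Cmd)
  /-- as long as register `x` is positive, do `c` -/
  | whilePos (x : ℕ) (c : Cmd)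
  /-- carry out procedure number `i` of the program -/
  | call (i : ℕ)

/-- A program is a finite list of procedures; the execution starts with procedure number `0`. -/
abbrev Program := List Cmd

/-- A configuration: the commands that are still to be carried out (the control stack), the
contents of the registers and the contents of the memory. -/
structure Config where
  todo : List Cmd
  reg : ℕ → ℤ
  mem : ℤ → ℤ

/-- Write `z` into register `r`; this is possible only if `z` fits into a word. -/
def setReg (W : ℕ) (todo : List Cmd) (s : Config) (r : ℕ) (z : ℤ) : Option Config :=
  if |z| ≤ (W : ℤ) then some ⟨todo, Function.update s.reg r z, s.mem⟩ else none

/-- One step of the machine with word bound `W` and program `P`.  The value is `none` if the machine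
has halted (nothing is left to be done) or is stuck (overflow, or call of a procedure that does not
exist). -/
def step (W : ℕ) (P : Program) (s : Config) : Option Config :=
  match s.todo with
  | [] => none
  | .skip :: k => some ⟨k, s.reg, s.mem⟩
  | .const r z :: k => setReg W k s r z
  | .arith op r x y :: k => setReg W k s r (op.eval (s.reg x) (s.reg y))
  | .load r x :: k => setReg W k s r (s.mem (s.reg x))
  | .store x r :: k => some ⟨k, s.reg, Function.update s.mem (s.reg x) (s.reg r)⟩
  | .seq c d :: k => some ⟨c :: d :: k, s.reg, s.mem⟩
  | .ifPos x c d :: k => some ⟨(if 0 < s.reg x then c else d) :: k, s.reg, s.mem⟩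
  | .whilePos x c :: k =>
      some ⟨if 0 < s.reg x then c :: .whilePos x c :: k else k, s.reg, s.mem⟩
  | .call i :: k => (P[i]?).map fun c => ⟨c :: k, s.reg, s.mem⟩

/-- The configuration after exactly `t` steps, if the machine gets that far. -/
def runSteps (W : ℕ) (P : Program) : ℕ → Config → Option Config
  | 0, s => some s
  | t + 1, s => (step W P s).bind (runSteps W P t)

/-- The initial configuration: the input words stand in the memory cells `0, 1, 2, …`, all other
memory cells and all registers are `0`. -/
def initial (input : List ℤ) : Config where
  todo := [.call 0]
  reg := fun _ => 0
  mem := fun a => if 0 ≤ a then input.getD a.toNat 0 else 0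

/-- On the given input, the machine with word bound `W` and program `P` halts after exactly `t`
steps, with output `(a, b)`: these are the final contents of the registers `0` and `1`. -/
def HaltsWith (W : ℕ) (P : Program) (input : List ℤ) (t : ℕ) (a b : ℤ) : Prop :=
  ∃ s : Config, runSteps W P t (initial input) = some s ∧
    s.todo = [] ∧ s.reg 0 = a ∧ s.reg 1 = b

end WordRAM

/-! ### Adjacency lists -/

/-- `adj v` lists the neighbours of `v`, each exactly once, in any order. -/
def IsAdjacencyLists {n : ℕ} (G : SimpleGraph (Fin n)) (adj : Fin n → List (Fin n)) : Prop :=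
  ∀ v, (adj v).Nodup ∧ ∀ w, w ∈ adj v ↔ G.Adj v w

/-- The input `(G, p, q)` as a list of words: `n`, `p`, `q`, then for `i = 0, …, n` the memory
address at which the list of vertex `i` starts (for `i = n`: the first address after all the lists),
and then the adjacency lists of the vertices `0, …, n - 1`, one after the other. -/
def graphInput {n : ℕ} (adj : Fin n → List (Fin n)) (p q : ℕ) : List ℤ :=
  [(n : ℤ), (p : ℤ), (q : ℤ)] ++
    (List.range (n + 1)).map
      (fun i => ((n + 4 + ∑ u : Fin n, if u.val < i then (adj u).length else 0 : ℕ) : ℤ)) ++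
    (List.finRange n).flatMap (fun v => (adj v).map fun w => (w.val : ℤ))

/-! ### Sink-free orientations -/

/-- `D` is an orientation of `G`: it has arcs only along edges of `G`, and exactly one of the two
possible arcs along each edge. -/
def IsOrientation {V : Type*} (G : SimpleGraph V) (D : Digraph V) : Prop :=
  (∀ u v, D.Adj u v → G.Adj u v) ∧ ∀ u v, G.Adj u v → Xor (D.Adj u v) (D.Adj v u)

/-- Every vertex has at least one outgoing arc. -/
def IsSinkFree {V : Type*} (D : Digraph V) : Prop :=
  ∀ v, ∃ w, D.Adj v w

/-- The number of sink-free orientations of `G`. -/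
noncomputable def sfo {V : Type*} (G : SimpleGraph V) : ℕ :=
  Nat.card {D : Digraph V // IsOrientation G D ∧ IsSinkFree D}

/-! Write N(S) for the number of orientations in which no vertex of S is a sink. Since N(∅) = 2^m
and N(V) = sfo(G), the number sfo(G) is 2^m times a telescoping product of factors N(S) / N(S \ {v})
= 1 - a(S,v), one for each vertex v. Here a(S,v) (`sinkRatio`) is the probability that v is a sink
in a random orientation counted by N(S \ {v}). If v is a sink, every neighbour has an arc to v, so
only the conditions outside the closed neighbourhood N[v] remain and the d edges at v are
determined: a(S,v) = 2^(-d) N(S \ N[v]) / N(S \ {v}) (`noSinkCount_eq_add`). The last quotient is a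
product of terms 1 / (1 - a(S',u)) over the neighbours u of v, removed one by one. This is a
recursion for the ratios.

Every u met in the recursion has the neighbour v outside S'. In that case a(S',u) ≤ 1/4
(`noSinkCount_pos_and_ratio`), and errors contract: at degree d they are multiplied by at most
(d-1)(2/3)^d ≤ (9/10)^d. So the recursion carries a budget k from which each vertex takes its
degree, and it answers 0 when the budget does not suffice. The truncation error is then O((9/10)^k)
(`approxRatio_of_approxFold`), and the time is O((3/2)^k) because d ≤ (3/2)^d (`nodeTime_rec`).

Ratios are stored as integers over Q = 2^l, and rounding costs a bounded number of units. With k =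
7l the truncation costs at most one more unit, and one evaluation takes O(Q^5) steps. The product is
kept as a mantissa times a power of 2; each of the n factors has relative error O(1/Q), so Q ≥ 32n/ε
suffices (`PartialEstimate.final`). The least such Q gives time O(n max(1, n/ε)^5), which is within
the claimed bound. On the machine, S is represented by counters that each call restores
(`nodeProc_spec`). -/

/-! ### Counting orientations without sinks in a given set -/

section Counting

variable {V : Type*} (G : SimpleGraph V)

/-- The number of orientations of `G` in which no vertex of `S` is a sink. -/
noncomputable def noSinkCount (S : Finset V) : ℕ :=
  Nat.card {D : Digraph V // IsOrientation G D ∧ ∀ v ∈ S, ∃ w, D.Adj v w}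

theorem noSinkCount_univ [Fintype V] : noSinkCount G Finset.univ = sfo G := by
  simp [noSinkCount, sfo, IsSinkFree]

/-- Orientations correspond to subsets of the edge set. -/
noncomputable def orientationEquiv [LinearOrder V] :
    {D : Digraph V // IsOrientation G D} ≃ (G.edgeSet → Prop) where
  toFun D e := D.1.Adj e.1.inf e.1.sup
  invFun X := ⟨⟨fun u v => ∃ h : G.Adj u v, if u < v then X ⟨s(u, v), h⟩ else ¬ X ⟨s(u, v), h⟩⟩,
    fun u v h => h.1, fun u v h => by
      have hs : (⟨s(v, u), h.symm⟩ : G.edgeSet) = ⟨s(u, v), h⟩ := Subtype.ext Sym2.eq_swap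
      have hne := h.ne
      rcases lt_or_gt_of_ne hne with hlt | hlt
      · simp [Xor, h, h.symm, hs, hlt, hlt.not_gt, em]
      · simp [Xor, h, h.symm, hs, hlt, hlt.not_gt, em, or_comm]⟩
  left_inv := by
    rintro ⟨D, hD⟩
    ext u v
    constructor
    · rintro ⟨h, hX⟩
      have hx := hD.2 u v h
      rcases lt_or_gt_of_ne h.ne with hlt | hlt
      · simpa [hlt, hlt.le] using hX
      · have hX' : ¬ D.Adj v u := by simpa [hlt.not_gt, hlt.le] using hX
        exact hx.elim And.left fun h => absurd h.1 hX'
    · intro huv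
      have h := hD.1 _ _ huv
      have hx := hD.2 u v h
      refine ⟨h, ?_⟩
      rcases lt_or_gt_of_ne h.ne with hlt | hlt
      · simpa [hlt, hlt.le] using huv
      · have : ¬ D.Adj v u := hx.elim And.right fun h => absurd huv h.2
        simpa [hlt.not_gt, hlt.le] using this
  right_inv := by
    intro X
    funext ⟨e, he⟩
    induction e using Sym2.ind with
    | _ u v =>
      have h : G.Adj u v := he
      have hs : (⟨s(v, u), h.symm⟩ : G.edgeSet) = ⟨s(u, v), h⟩ := Subtype.ext Sym2.eq_swap
      rcases lt_or_gt_of_ne h.ne with hlt | hlt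
      · simp [hlt, hlt.le, h]
      · simp [hlt, hlt.le, h.symm, hs]

theorem noSinkCount_empty [Fintype V] [LinearOrder V] [DecidableRel G.Adj] :
    noSinkCount G ∅ = 2 ^ G.edgeFinset.card := by
  have e : {D : Digraph V // IsOrientation G D ∧ ∀ v ∈ (∅ : Finset V), ∃ w, D.Adj v w} ≃
      (G.edgeSet → Prop) :=
    (Equiv.subtypeEquivRight fun D => by simp).trans (orientationEquiv G)
  rw [noSinkCount, Nat.card_congr e, Nat.card_eq_fintype_card, Fintype.card_fun,
    SimpleGraph.edgeFinset_card]
  simp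

instance [Finite V] : Finite (Digraph V) :=
  Finite.of_injective (fun D : Digraph V => D.Adj) fun _ _ h => Digraph.ext h

/-- The edges at `v` can be oriented freely if no condition is imposed on the vertices of the
closed neighbourhood of `v`. -/
noncomputable def freeStarEquiv (v : V) (T : Finset V) (hv : v ∉ T)
    (hT : ∀ u, G.Adj v u → u ∉ T) :
    {D : Digraph V // IsOrientation G D ∧ ∀ u ∈ T, ∃ w, D.Adj u w} ≃
      {D : Digraph V // (IsOrientation G D ∧ ∀ u ∈ T, ∃ w, D.Adj u w) ∧ ¬ ∃ w, D.Adj v w} ×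
        (G.neighborSet v → Prop) := by
  classical
  -- No arc that leaves a vertex of `T` touches `v`, so reorienting the edges at `v` does not affect
  -- the conditions on `T`.
  have hne : ∀ u ∈ T, ∀ w, G.Adj u w → u ≠ v ∧ w ≠ v := fun u hu w h =>
    ⟨fun e => hv (e ▸ hu), fun e => hT u (e ▸ h.symm) hu⟩
  -- The forward map turns all edges at `v` towards `v` and records which of them used to leave `v`.
  refine
    { toFun := fun D => (⟨⟨fun a b => if a = v then False else if b = v then G.Adj a b
          else D.1.Adj a b⟩, ⟨⟨?_, ?_⟩, ?_⟩, by simp⟩, fun w => D.1.Adj v w)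
      invFun := fun D => ⟨⟨fun a b => if a = v then ∃ h : G.Adj v b, D.2 ⟨b, h⟩
          else if b = v then ∃ h : G.Adj v a, ¬ D.2 ⟨a, h⟩ else D.1.1.Adj a b⟩, ⟨?_, ?_⟩, ?_⟩
      left_inv := ?_
      right_inv := ?_ }
  · intro a b h
    obtain ⟨D, ⟨h1, h2⟩, h3⟩ := D
    grind
  · intro a b h
    obtain ⟨D, ⟨h1, h2⟩, h3⟩ := D
    have := h2 a b h
    have := h.ne
    have := h.symm
    by_cases ha : a = v <;> by_cases hb : b = v <;> simp_all [Xor]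
  · intro u hu
    obtain ⟨D, ⟨h1, h2⟩, h3⟩ := D
    obtain ⟨w, hw⟩ := h3 u hu
    have := hne u hu w (h1 _ _ hw)
    exact ⟨w, by simpa [this] using hw⟩
  · intro a b h
    obtain ⟨⟨D, ⟨⟨h1, h2⟩, h3⟩, h4⟩, X⟩ := D
    by_cases ha : a = v
    · subst ha
      simp only [if_true] at h
      exact h.1
    · by_cases hb : b = v
      · subst hb
        simp only [ha, if_true, if_false] at h
        exact h.1.symm
      · simp only [ha, hb, if_false] at h
        exact h1 _ _ h
  · intro a b h
    obtain ⟨⟨D, ⟨⟨h1, h2⟩, h3⟩, h4⟩, X⟩ := D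
    have hx := h2 a b h
    by_cases ha : a = v
    · subst ha
      simp [Xor, h.ne', h, em]
    · by_cases hb : b = v
      · subst hb
        simp [Xor, h.ne, h.symm, em, or_comm]
      · simpa [ha, hb] using hx
  · intro u hu
    obtain ⟨⟨D, ⟨⟨h1, h2⟩, h3⟩, h4⟩, X⟩ := D
    obtain ⟨w, hw⟩ := h3 u hu
    have := hne u hu w (h1 _ _ hw)
    exact ⟨w, by simpa [this] using hw⟩
  · rintro ⟨D, ⟨h1, h2⟩, h3⟩
    ext a b
    by_cases ha : a = v
    · subst ha
      simpa using h1 a b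
    · by_cases hb : b = v
      · subst hb
        have h5 := h1 a b
        have h6 := h2 a b
        have h7 := G.adj_comm a b
        simp [ha]
        grind [Xor]
      · simp [ha, hb]
  · rintro ⟨⟨D, ⟨⟨h1, h2⟩, h3⟩, h4⟩, X⟩
    push Not at h4
    ext a b
    · have h5 := h1 a b
      have h6 := h2 a b
      have h7 := G.adj_comm a b
      have h8 := h4 a
      have h9 := h4 b
      by_cases ha : a = v
      · subst ha
        simp [h4]
      · by_cases hb : b = v
        · subst hb
          simp [ha]
          grind [Xor]
        · simp [ha, hb]
    · have ha : G.Adj v a := a.2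
      simp [ha]

variable [Fintype V] [DecidableEq V] [DecidableRel G.Adj]

/-- The orientations in which `v` is a sink leave no condition on the neighbours of `v`. -/
theorem noSinkCount_eq_add {S : Finset V} {v : V} (hv : v ∈ S) :
    2 ^ G.degree v * noSinkCount G (S.erase v) =
      2 ^ G.degree v * noSinkCount G S +
        noSinkCount G (S \ insert v (G.neighborFinset v)) := by
  classical
  set T := S \ insert v (G.neighborFinset v)
  have hvT : v ∉ T := by simp [T]
  have hT : ∀ u, G.Adj v u → u ∉ T := by
    intro u hu
    simp [T, hu]
  have e1 := Nat.card_congr (freeStarEquiv G v T hvT hT)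
  rw [Nat.card_prod, Nat.card_eq_fintype_card (α := G.neighborSet v → Prop), Fintype.card_fun,
    Fintype.card_prop, G.card_neighborSet_eq_degree] at e1
  -- Once `v` is a sink, each neighbour has an arc to `v`, so its condition holds automatically and
  -- only `T` is left.
  have e2 : {D : Digraph V // (IsOrientation G D ∧ ∀ u ∈ T, ∃ w, D.Adj u w) ∧ ¬ ∃ w, D.Adj v w} ≃
      {D : Digraph V // (IsOrientation G D ∧ ∀ u ∈ S.erase v, ∃ w, D.Adj u w) ∧
        ¬ ∃ w, D.Adj v w} := by
    refine Equiv.subtypeEquivRight fun D => ?_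
    refine and_congr_left fun hs => and_congr_right fun hD => ⟨fun h u hu => ?_, fun h u hu => ?_⟩
    · by_cases huv : G.Adj v u
      · have := hD.2 v u huv
        push Not at hs
        exact ⟨v, by simpa [Xor, hs u] using this⟩
      · refine h u ?_
        have := Finset.mem_erase.1 hu
        simp [T, this.1, this.2, huv]
    · refine h u ?_
      simp only [T, Finset.mem_sdiff, Finset.mem_insert, not_or] at hu
      exact Finset.mem_erase.2 ⟨hu.2.1, hu.1⟩
  have e3 : {D : Digraph V // IsOrientation G D ∧ ∀ u ∈ S, ∃ w, D.Adj u w} ≃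
      {D : Digraph V // (IsOrientation G D ∧ ∀ u ∈ S.erase v, ∃ w, D.Adj u w) ∧
        ∃ w, D.Adj v w} := by
    refine Equiv.subtypeEquivRight fun D => ?_
    rw [and_assoc]
    refine and_congr_right fun _ => ⟨fun h => ⟨fun u hu => h u (Finset.mem_of_mem_erase hu),
      h v hv⟩, fun h u hu => ?_⟩
    by_cases huv : u = v
    · exact huv ▸ h.2
    · exact h.1 u (Finset.mem_erase.2 ⟨huv, hu⟩)
  have e4 : noSinkCount G (S.erase v) = noSinkCount G S +
      Nat.card {D : Digraph V // (IsOrientation G D ∧ ∀ u ∈ T, ∃ w, D.Adj u w) ∧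
        ¬ ∃ w, D.Adj v w} := by
    rw [noSinkCount, noSinkCount, Nat.card_congr e2, Nat.card_congr e3]
    have := Nat.card_congr (Equiv.sumCompl (fun D : {D : Digraph V // IsOrientation G D ∧
      ∀ u ∈ S.erase v, ∃ w, D.Adj u w} => ∃ w, D.1.Adj v w)).symm
    rw [this, Nat.card_sum]
    congr 1
    · exact Nat.card_congr (Equiv.subtypeSubtypeEquivSubtypeInter _
        (fun D : Digraph V => ∃ w, D.Adj v w))
    · exact Nat.card_congr (Equiv.subtypeSubtypeEquivSubtypeInter _
        (fun D : Digraph V => ¬ ∃ w, D.Adj v w))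
  rw [e4, mul_add, show noSinkCount G T = _ from e1, mul_comm (Nat.card _)]

end Counting

/-! ### Ratios of numbers of orientations -/

/-- Controls the constant 8 in `errBound`: 3 + 8 * (16/27) < 8. -/
theorem sub_one_mul_pow_two_thirds_le (d : ℕ) (hd : 3 ≤ d) :
    ((d : ℝ) - 1) * (2 / 3) ^ d ≤ 16 / 27 := by
  induction d, hd using Nat.le_induction with
  | base => norm_num
  | succ d hd ih =>
    have h3 : (3 : ℝ) ≤ d := by exact_mod_cast hd
    have hp : (0 : ℝ) < (2 / 3) ^ d := by positivity
    rw [pow_succ]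
    push_cast
    nlinarith

/-- Equivalent to (d-1)(2/3)^d ≤ (9/10)^d: a vertex of degree d may spend d units of the budget. -/
theorem sub_one_mul_pow_le_one (d : ℕ) (hd : 3 ≤ d) :
    ((d : ℝ) - 1) * (20 / 27) ^ d ≤ 1 := by
  -- The left side still increases from d = 3 to d = 4 and decreases only from there on.
  rcases hd.eq_or_lt with rfl | hlt
  · norm_num
  clear hd
  have h4 : 4 ≤ d := hlt
  clear hlt
  induction d, h4 using Nat.le_induction with
  | base => norm_num
  | succ d hd ih =>
    have h3 : (4 : ℝ) ≤ d := by exact_mod_cast hd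
    have hp : (0 : ℝ) < (20 / 27) ^ d := by positivity
    rw [pow_succ]
    push_cast
    nlinarith

/-- Branching into d calls is paid for by d units of budget at the rate 3/2. -/
theorem natCast_le_three_halves_pow (d : ℕ) : (d : ℝ) ≤ (3 / 2) ^ d := by
  rcases le_or_gt d 2 with h | h
  · interval_cases d <;> norm_num
  have h : 3 ≤ d := h
  induction d, h using Nat.le_induction with
  | base => norm_num
  | succ d hd ih =>
    have h3 : (3 : ℝ) ≤ d := by exact_mod_cast hd
    have := ih (by omega)
    rw [pow_succ]
    push_cast
    nlinarith

section Ratio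

theorem sdiff_insert_eq_erase_sdiff {α : Type*} [DecidableEq α] (S X : Finset α) (v : α) :
    S \ insert v X = S.erase v \ X := by
  grind

variable {n : ℕ} (G : SimpleGraph (Fin n)) [DecidableRel G.Adj]

/-- Of the orientations without sinks in `S \ {v}`, the fraction in which `v ∈ S` is a sink. -/
noncomputable def sinkRatio (S : Finset (Fin n)) (v : Fin n) : ℝ :=
  1 - (noSinkCount G S : ℝ) / noSinkCount G (S.erase v)

theorem noSinkCount_eq_sub {S : Finset (Fin n)} {v : Fin n} (hv : v ∈ S) :
    (noSinkCount G S : ℝ) = noSinkCount G (S.erase v) -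
      (1 / 2) ^ G.degree v * noSinkCount G (S \ insert v (G.neighborFinset v)) := by
  have h : (2 : ℝ) ^ G.degree v * noSinkCount G (S.erase v) =
      2 ^ G.degree v * noSinkCount G S +
        noSinkCount G (S \ insert v (G.neighborFinset v)) := by
    exact_mod_cast noSinkCount_eq_add G hv
  have h2 : (2 : ℝ) ^ G.degree v * (1 / 2) ^ G.degree v = 1 := by
    rw [← mul_pow]
    norm_num
  have hp : (0 : ℝ) < (1 / 2) ^ G.degree v := by positivity
  linear_combination (-(1 / 2 : ℝ) ^ G.degree v) * h +
    ((noSinkCount G (S.erase v) : ℝ) - noSinkCount G S) * h2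

/-- Removing neighbours of a vertex outside `S` one by one. -/
theorem pow_mul_noSinkCount_sdiff_le {S : Finset (Fin n)} {v : Fin n} (hv : v ∉ S)
    (ih : ∀ S' ⊆ S, ∀ u ∈ S', (∃ w, G.Adj u w ∧ w ∉ S') →
      3 / 4 * (noSinkCount G (S'.erase u) : ℝ) ≤ noSinkCount G S')
    (X : Finset (Fin n)) (hX : X ⊆ G.neighborFinset v) :
    (3 / 4 : ℝ) ^ (X ∩ S).card * noSinkCount G (S \ X) ≤ noSinkCount G S := by
  induction X using Finset.induction_on with
  | empty => simp
  | insert u X hu ihX =>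
    have h1 := ihX ((Finset.subset_insert _ _).trans hX)
    by_cases huS : u ∈ S
    · have huX : u ∈ S \ X := Finset.mem_sdiff.2 ⟨huS, hu⟩
      have hadj : G.Adj u v := by
        have := hX (Finset.mem_insert_self u X)
        simpa [G.adj_comm] using this
      have h2 := ih (S \ X) Finset.sdiff_subset u huX ⟨v, hadj, by simp [hv]⟩
      rw [Finset.insert_inter_of_mem huS, Finset.card_insert_of_notMem (by simp [hu]), pow_succ,
        Finset.sdiff_insert, mul_assoc]
      exact (mul_le_mul_of_nonneg_left h2 (by positivity)).trans h1
    · rw [Finset.insert_inter_of_notMem huS, Finset.sdiff_insert_of_notMem huS]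
      exact h1

theorem card_neighborFinset_inter_le {S : Finset (Fin n)} {v w : Fin n} (hw : G.Adj v w)
    (hwS : w ∉ S) : (G.neighborFinset v ∩ S).card + 1 ≤ G.degree v := by
  rw [← G.card_neighborFinset_eq_degree]
  refine Finset.card_lt_card ⟨Finset.inter_subset_left, fun h => hwS ?_⟩
  exact (Finset.mem_inter.1 (h (by simpa using hw))).2

/-- This closes the induction on the bound 1/4: with one neighbour already outside the set, at most
d - 1 factors 4/3 occur, and (3/4)(2/3)^d ≤ 2/9 for d ≥ 3. -/
theorem half_pow_mul_le_quarter {c d : ℕ} (hd : 3 ≤ d) (hc : c + 1 ≤ d) :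
    (1 / 2 : ℝ) ^ d * (4 / 3) ^ c ≤ 1 / 4 := by
  obtain ⟨k, rfl⟩ := Nat.exists_eq_add_of_le hd
  calc (1 / 2 : ℝ) ^ (3 + k) * (4 / 3) ^ c ≤ (1 / 2) ^ (3 + k) * (4 / 3) ^ (2 + k) := by
        gcongr
        · norm_num
        · omega
    _ = 2 / 9 * (2 / 3) ^ k := by
        rw [pow_add, pow_add, mul_mul_mul_comm, ← mul_pow]
        norm_num
    _ ≤ 2 / 9 * 1 := by
        gcongr
        exact pow_le_one₀ (by norm_num) (by norm_num)
    _ ≤ 1 / 4 := by norm_num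

theorem half_pow_mul_le_two_thirds {c d : ℕ} (hc : c ≤ d) :
    (1 / 2 : ℝ) ^ d * (4 / 3) ^ c ≤ (2 / 3) ^ d := by
  calc (1 / 2 : ℝ) ^ d * (4 / 3) ^ c ≤ (1 / 2) ^ d * (4 / 3) ^ d := by
        gcongr
        norm_num
    _ = (2 / 3) ^ d := by rw [← mul_pow]; norm_num

theorem two_thirds_pow_le {d : ℕ} (hd : 3 ≤ d) : (2 / 3 : ℝ) ^ d ≤ 8 / 27 := by
  calc (2 / 3 : ℝ) ^ d ≤ (2 / 3) ^ 3 := pow_le_pow_of_le_one (by norm_num) (by norm_num) hd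
    _ = 8 / 27 := by norm_num

/-- The neighbours are removed from `S.erase v`; each of them has `v` outside the set, so each
removal multiplies the count by at most 4/3. -/
theorem noSinkCount_sdiff_le {S : Finset (Fin n)} {v : Fin n}
    (ih : ∀ S' ⊆ S.erase v, ∀ u ∈ S', (∃ w, G.Adj u w ∧ w ∉ S') →
      3 / 4 * (noSinkCount G (S'.erase u) : ℝ) ≤ noSinkCount G S') :
    (noSinkCount G (S \ insert v (G.neighborFinset v)) : ℝ) ≤
      (4 / 3) ^ (G.neighborFinset v ∩ S).card * noSinkCount G (S.erase v) := by
  have h := pow_mul_noSinkCount_sdiff_le G (S.notMem_erase v) ih (G.neighborFinset v) subset_rfl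
  rw [← sdiff_insert_eq_erase_sdiff] at h
  have hE : G.neighborFinset v ∩ S.erase v = G.neighborFinset v ∩ S := by
    ext u
    have : G.Adj v u → u ≠ v := fun h => h.ne'
    simp
    tauto
  rw [hE] at h
  set c := (G.neighborFinset v ∩ S).card
  have h1 : (4 / 3 : ℝ) ^ c * (3 / 4) ^ c = 1 := by
    rw [← mul_pow]
    norm_num
  calc (noSinkCount G (S \ insert v (G.neighborFinset v)) : ℝ)
      = (4 / 3 : ℝ) ^ c *
          ((3 / 4 : ℝ) ^ c * noSinkCount G (S \ insert v (G.neighborFinset v))) := by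
        rw [← mul_assoc, h1, one_mul]
    _ ≤ _ := by gcongr

variable (hdeg : ∀ v, 3 ≤ G.degree v)
include hdeg

/-- Both claims are proved together by induction on `S`. By the ratio bound for smaller sets, the
sink ratio at `v` is at most (1/2)^d (4/3)^c, where c counts the neighbours in `S`. This is at most
8/27 < 1 in general, which gives positivity, and at most 1/4 if a neighbour is missing from `S`. -/
theorem noSinkCount_pos_and_ratio (S : Finset (Fin n)) :
    (0 : ℝ) < noSinkCount G S ∧ ∀ v ∈ S, (∃ w, G.Adj v w ∧ w ∉ S) →
      3 / 4 * (noSinkCount G (S.erase v) : ℝ) ≤ noSinkCount G S := by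
  induction S using Finset.strongInduction with
  | H S ih =>
  have key : ∀ v ∈ S, (1 - (1 / 2) ^ G.degree v * (4 / 3) ^ (G.neighborFinset v ∩ S).card) *
      (noSinkCount G (S.erase v) : ℝ) ≤ noSinkCount G S := by
    intro v hv
    have h := noSinkCount_sdiff_le G (S := S) (v := v) fun S' hS' =>
      (ih S' (hS'.trans_ssubset (Finset.erase_ssubset hv))).2
    rw [noSinkCount_eq_sub G hv]
    have := mul_le_mul_of_nonneg_left h (show (0 : ℝ) ≤ (1 / 2) ^ G.degree v by positivity)
    linarith
  constructor
  · rcases S.eq_empty_or_nonempty with rfl | ⟨v, hv⟩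
    · rw [noSinkCount_empty]
      positivity
    · have h1 := (ih _ (Finset.erase_ssubset hv)).1
      have h2 := half_pow_mul_le_two_thirds (c := (G.neighborFinset v ∩ S).card)
        (d := G.degree v)
        ((Finset.card_le_card Finset.inter_subset_left).trans_eq
          (G.card_neighborFinset_eq_degree v))
      have h3 := two_thirds_pow_le (hdeg v)
      exact (mul_pos (by linarith) h1).trans_le (key v hv)
  · rintro v hv ⟨w, hw, hwS⟩
    have h1 := (ih _ (Finset.erase_ssubset hv)).1
    have h2 := half_pow_mul_le_quarter (hdeg v) (card_neighborFinset_inter_le G hw hwS)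
    exact (mul_le_mul_of_nonneg_right (by linarith) h1.le).trans (key v hv)

theorem noSinkCount_pos (S : Finset (Fin n)) : (0 : ℝ) < noSinkCount G S :=
  (noSinkCount_pos_and_ratio G hdeg S).1

theorem sinkRatio_of_notMem {S : Finset (Fin n)} {v : Fin n} (hv : v ∉ S) :
    sinkRatio G S v = 0 := by
  rw [sinkRatio, Finset.erase_eq_of_notMem hv, div_self (noSinkCount_pos G hdeg S).ne', sub_self]

theorem sinkRatio_eq {S : Finset (Fin n)} {v : Fin n} (hv : v ∈ S) :
    sinkRatio G S v = (1 / 2) ^ G.degree v *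
      (noSinkCount G (S \ insert v (G.neighborFinset v)) / noSinkCount G (S.erase v)) := by
  have h := (noSinkCount_pos G hdeg (S.erase v)).ne'
  rw [sinkRatio, noSinkCount_eq_sub G hv]
  field_simp
  ring

theorem sinkRatio_nonneg (S : Finset (Fin n)) (v : Fin n) : 0 ≤ sinkRatio G S v := by
  by_cases hv : v ∈ S
  · rw [sinkRatio_eq G hdeg hv]
    positivity
  · rw [sinkRatio_of_notMem G hdeg hv]

theorem sinkRatio_le {S : Finset (Fin n)} {v : Fin n} (hv : v ∈ S) :
    sinkRatio G S v ≤ (1 / 2) ^ G.degree v * (4 / 3) ^ (G.neighborFinset v ∩ S).card := by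
  rw [sinkRatio_eq G hdeg hv]
  gcongr
  rw [div_le_iff₀ (noSinkCount_pos G hdeg _)]
  exact noSinkCount_sdiff_le G fun S' _ => (noSinkCount_pos_and_ratio G hdeg S').2

theorem sinkRatio_le_two_thirds_pow {S : Finset (Fin n)} {v : Fin n} (hv : v ∈ S) :
    sinkRatio G S v ≤ (2 / 3) ^ G.degree v :=
  (sinkRatio_le G hdeg hv).trans (half_pow_mul_le_two_thirds
    ((Finset.card_le_card Finset.inter_subset_left).trans_eq (G.card_neighborFinset_eq_degree v)))

theorem sinkRatio_le_quarter {S : Finset (Fin n)} {v w : Fin n} (hw : G.Adj v w) (hwS : w ∉ S) :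
    sinkRatio G S v ≤ 1 / 4 := by
  by_cases hv : v ∈ S
  · exact (sinkRatio_le G hdeg hv).trans
      (half_pow_mul_le_quarter (hdeg v) (card_neighborFinset_inter_le G hw hwS))
  · rw [sinkRatio_of_notMem G hdeg hv]
    norm_num

theorem noSinkCount_erase_mul (S : Finset (Fin n)) (v : Fin n) :
    (noSinkCount G (S.erase v) : ℝ) * (1 - sinkRatio G S v) = noSinkCount G S := by
  have h := (noSinkCount_pos G hdeg (S.erase v)).ne'
  rw [sinkRatio]
  field_simp
  ring

/-! ### Approximations of the ratios -/

/-- A bound for the error of the approximation of a sink ratio with scaling factor `Q` and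
budget `k`. -/
noncomputable def errBound (Q : ℤ) (k : ℤ) : ℝ := 8 + Q * (9 / 10 : ℝ) ^ k.toNat

/-- `A / Q` approximates the sink ratio from below. -/
def ApproxRatio (Q k : ℤ) (S : Finset (Fin n)) (v : Fin n) (A : ℤ) : Prop :=
  0 ≤ A ∧ (A : ℝ) ≤ Q * sinkRatio G S v ∧ Q * sinkRatio G S v - A ≤ 2 * errBound Q k ∧
    ((∃ w, G.Adj v w ∧ w ∉ S) → Q * sinkRatio G S v - A ≤ errBound Q k)

/-- When the budget does not cover the degree, the ratio itself is at most (2/3)^d ≤ (9/10)^k, so 0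
is a good enough answer. -/
theorem approxRatio_zero {Q k : ℤ} (hQ : 0 ≤ Q) {S : Finset (Fin n)} {v : Fin n}
    (hv : v ∈ S) (hk : k < G.degree v) : ApproxRatio G Q k S v 0 := by
  have h1 := sinkRatio_nonneg G hdeg S v
  have h2 := sinkRatio_le_two_thirds_pow G hdeg hv
  have hQ' : (0 : ℝ) ≤ Q := by exact_mod_cast hQ
  have h3 : (2 / 3 : ℝ) ^ G.degree v ≤ (9 / 10) ^ k.toNat :=
    calc (2 / 3 : ℝ) ^ G.degree v ≤ (9 / 10) ^ G.degree v := by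
          exact pow_le_pow_left₀ (by norm_num) (by norm_num) _
      _ ≤ (9 / 10) ^ k.toNat :=
        pow_le_pow_of_le_one (by norm_num) (by norm_num) (by have := hdeg v; omega)
  have h4 := mul_le_mul_of_nonneg_left (h2.trans h3) hQ'
  have h5 : 0 ≤ (Q : ℝ) * (9 / 10) ^ k.toNat := by positivity
  refine ⟨le_rfl, by push_cast; positivity, ?_, fun _ => ?_⟩ <;>
    simp only [errBound] <;> push_cast <;> linarith

omit hdeg in
/-- The state of the approximate evaluation of a sink ratio at `v`, after `j` neighbours of `v`,
of which `c` belonged to the initial set `S₀`, have been removed with result `S`. -/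
def ApproxFold (Q : ℤ) (η : ℝ) (S₀ S : Finset (Fin n)) (j c : ℕ) (T : ℤ) : Prop :=
  0 ≤ T ∧ (T : ℝ) ≤ Q * ((1 / 2) ^ j * (noSinkCount G S / noSinkCount G S₀)) ∧
    Q * ((1 / 2) ^ j * (noSinkCount G S / noSinkCount G S₀)) - T ≤
      3 + c * (4 / 3 * η) * ((1 / 2) ^ j * (noSinkCount G S / noSinkCount G S₀))

theorem approxFold_init (Q : ℤ) (hQ : 0 ≤ Q) (η : ℝ) (S₀ : Finset (Fin n)) :
    ApproxFold G Q η S₀ S₀ 0 0 Q := by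
  have h := (noSinkCount_pos G hdeg S₀).ne'
  refine ⟨hQ, ?_, ?_⟩ <;> simp [h]

omit hdeg in
/-- One step of the fixed point evaluation. -/
theorem fixedPoint_step {Q A T : ℤ} {a x κ η : ℝ} (hQ : 0 < Q) (hA : 0 ≤ A)
    (hAa : (A : ℝ) ≤ Q * a) (ha : a ≤ 1 / 4) (hη : Q * a - A ≤ η) (hT : 0 ≤ T)
    (hTx : (T : ℝ) ≤ Q * x) (hκ : 0 ≤ κ) (herr : Q * x - T ≤ 3 + κ * x) :
    0 ≤ T * Q / (2 * (Q - A)) ∧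
      ((T * Q / (2 * (Q - A)) : ℤ) : ℝ) ≤ Q * (1 / 2 * x / (1 - a)) ∧
      Q * (1 / 2 * x / (1 - a)) - (T * Q / (2 * (Q - A)) : ℤ) ≤
        3 + (κ + 4 / 3 * η) * (1 / 2 * x / (1 - a)) := by
  have hQ' : (0 : ℝ) < Q := by exact_mod_cast hQ
  have hT' : (0 : ℝ) ≤ T := by exact_mod_cast hT
  have hA' : (0 : ℝ) ≤ A := by exact_mod_cast hA
  have hx : 0 ≤ x := by
    by_contra hneg
    nlinarith
  have hAQ : (A : ℝ) ≤ Q / 4 := by nlinarith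
  have hD : (0 : ℝ) < 2 * (Q - A) := by linarith
  have hDZ : 0 < 2 * (Q - A) := by
    have : ((0 : ℤ) : ℝ) < ((2 * (Q - A) : ℤ) : ℝ) := by push_cast; exact hD
    exact_mod_cast this
  set Z := T * Q / (2 * (Q - A))
  have hZ1 : (Z : ℝ) * (2 * (Q - A)) ≤ T * Q := by
    have := Int.ediv_mul_le (T * Q) hDZ.ne'
    exact_mod_cast this
  have hZ2 : (T : ℝ) * Q < (Z + 1) * (2 * (Q - A)) := by
    have := Int.lt_ediv_add_one_mul_self (T * Q) hDZ
    exact_mod_cast this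
  have h1a : 0 < 1 - a := by linarith
  set y := 1 / 2 * x / (1 - a) with hy
  have hyx : y * (1 - a) = 1 / 2 * x := by rw [hy]; field_simp
  have hy0 : 0 ≤ y := by positivity
  -- the exact quotient
  set u := (T : ℝ) * Q / (2 * (Q - A)) with hu
  have hu1 : u * (2 * (Q - A)) = T * Q := div_mul_cancel₀ _ hD.ne'
  have hZu : (Z : ℝ) ≤ u := by
    rw [hu, le_div_iff₀ hD]; exact hZ1
  have huZ : u < Z + 1 := by
    rw [hu, div_lt_iff₀ hD]; exact hZ2
  -- compare with the true value
  have huy : u ≤ Q * y := by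
    rw [hu, div_le_iff₀ hD]
    have h2 : (T : ℝ) * Q ≤ Q * x * Q := mul_le_mul_of_nonneg_right hTx hQ'.le
    have h3 : x * Q = y * (2 * (Q - Q * a)) := by linear_combination (-2 * (Q : ℝ)) * hyx
    have h4 : y * (2 * (Q - Q * a)) ≤ y * (2 * (Q - A)) :=
      mul_le_mul_of_nonneg_left (by linarith) hy0
    nlinarith
  refine ⟨Int.ediv_nonneg (by positivity) hDZ.le, hZu.trans huy, ?_⟩
  have hη0 : 0 ≤ η := by linarith
  -- `Q y - u = (Q y (Q - A) - T Q / 2) / (Q - A)`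
  have h5 : (Q * y - u) * (2 * (Q - A)) ≤ (2 + (κ + 4 / 3 * η) * y) * (2 * (Q - A)) := by
    have e1 : (Q * y - u) * (2 * (Q - A)) = 2 * Q * y * (Q * a - A) + Q * (Q * x - T) := by
      linear_combination (-1 : ℝ) * hu1 + 2 * (Q : ℝ) * Q * hyx
    have e2 : Q * (Q * x - T) ≤ Q * (3 + κ * x) := mul_le_mul_of_nonneg_left herr hQ'.le
    have e3 : 2 * Q * y * (Q * a - A) ≤ 2 * Q * y * η :=
      mul_le_mul_of_nonneg_left hη (by positivity)
    have e4 : κ * (Q * x) ≤ κ * (y * (2 * (Q - A))) := by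
      refine mul_le_mul_of_nonneg_left ?_ hκ
      have h3 : x * Q = y * (2 * (Q - Q * a)) := by linear_combination (-2 * (Q : ℝ)) * hyx
      have h4 : y * (2 * (Q - Q * a)) ≤ y * (2 * (Q - A)) :=
        mul_le_mul_of_nonneg_left (by linarith) hy0
      linarith
    -- Since a ≤ 1/4, the divisor satisfies Q - A ≥ 3Q/4; this is the origin of the factor 4/3.
    have e5 : y * η * Q ≤ y * η * (4 / 3 * (Q - A)) :=
      mul_le_mul_of_nonneg_left (by linarith) (by positivity)
    nlinarith
  -- The old constant 3 has shrunk to 2, because Q / (2(Q - A)) ≤ 2/3; the floor costs 1, which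
  -- restores 3.
  have h6 := le_of_mul_le_mul_right h5 hD
  linarith

/-- Removing `u` divides the count by 1 - `sinkRatio G S u`. In the application `w` is the vertex
under evaluation: it is adjacent to `u` and already outside `S`, so the ratio is at most 1/4. A
neighbour that is no longer in `S` has ratio exactly 0 and adds no error, hence `c` counts only the
others. -/
theorem approxFold_step {Q k : ℤ} (hQ : 0 < Q) {S₀ S : Finset (Fin n)} {j c : ℕ} {T A : ℤ}
    {u w : Fin n} (hw : G.Adj u w) (hwS : w ∉ S)
    (hT : ApproxFold G Q (errBound Q k) S₀ S j c T)
    (hA : (u ∉ S ∧ A = 0) ∨ (u ∈ S ∧ ApproxRatio G Q k S u A)) :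
    ApproxFold G Q (errBound Q k) S₀ (S.erase u) (j + 1) (if u ∈ S then c + 1 else c)
      (T * Q / (2 * (Q - A))) := by
  have ha := sinkRatio_le_quarter G hdeg hw hwS
  obtain ⟨hT1, hT2, hT3⟩ := hT
  have hQ' : (0 : ℝ) < Q := by exact_mod_cast hQ
  have herr : 0 ≤ errBound Q k := by unfold errBound; positivity
  have hx : (1 / 2 : ℝ) ^ (j + 1) * (noSinkCount G (S.erase u) / noSinkCount G S₀) =
      1 / 2 * ((1 / 2) ^ j * (noSinkCount G S / noSinkCount G S₀)) / (1 - sinkRatio G S u) := by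
    have h1 : 1 - sinkRatio G S u ≠ 0 := by linarith
    have h2 := noSinkCount_erase_mul G hdeg S u
    rw [eq_div_iff h1, ← h2]
    ring
  have hA0 : 0 ≤ A := by
    rcases hA with ⟨-, rfl⟩ | ⟨-, h⟩
    exacts [le_rfl, h.1]
  have hAa : (A : ℝ) ≤ Q * sinkRatio G S u := by
    rcases hA with ⟨h, rfl⟩ | ⟨-, h⟩
    · rw [sinkRatio_of_notMem G hdeg h]; simp
    · exact h.2.1
  have hη : Q * sinkRatio G S u - A ≤ if u ∈ S then errBound Q k else 0 := by
    rcases hA with ⟨h, rfl⟩ | ⟨h', h⟩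
    · rw [sinkRatio_of_notMem G hdeg h]; simp [h]
    · rw [if_pos h']; exact h.2.2.2 ⟨w, hw, hwS⟩
  have := fixedPoint_step hQ hA0 hAa ha hη hT1 hT2
    (show (0 : ℝ) ≤ c * (4 / 3 * errBound Q k) by positivity) hT3
  rw [ApproxFold, hx]
  refine ⟨this.1, this.2.1, this.2.2.trans_eq ?_⟩
  split_ifs <;> push_cast <;> ring

/-- The error 3 + c (4/3) η a, with η the bound for the remaining budget and a the ratio at `v`, has
to reproduce `errBound`. With a neighbour outside `S` it is at most 3 + (d-1)(2/3)^d η, and the two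
numerical lemmas on d handle the summands 8 and Q(9/10)^k. Otherwise a factor 2 is lost; this is
harmless, because it can occur only at the root of the recursion. -/
theorem approxRatio_of_approxFold {Q k : ℤ} (hQ : 0 < Q) {S : Finset (Fin n)} {v : Fin n}
    (hv : v ∈ S) (hk : (G.degree v : ℤ) ≤ k) {T : ℤ}
    (hT : ApproxFold G Q (errBound Q (k - G.degree v)) (S.erase v)
      (S \ insert v (G.neighborFinset v)) (G.degree v) (G.neighborFinset v ∩ S).card T) :
    ApproxRatio G Q k S v T := by
  obtain ⟨h1, h2, h3⟩ := hT
  rw [← sinkRatio_eq G hdeg hv] at h2 h3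
  have hQ' : (0 : ℝ) < Q := by exact_mod_cast hQ
  have h4 := sinkRatio_le_two_thirds_pow G hdeg hv
  have h0 := sinkRatio_nonneg G hdeg S v
  have hd := hdeg v
  have hd' : (3 : ℝ) ≤ G.degree v := by exact_mod_cast hd
  have b1 := sub_one_mul_pow_two_thirds_le _ hd
  have b2 := sub_one_mul_pow_le_one _ hd
  have b3 := two_thirds_pow_le hd
  have hc : (G.neighborFinset v ∩ S).card ≤ G.degree v :=
    (Finset.card_le_card Finset.inter_subset_left).trans_eq (G.card_neighborFinset_eq_degree v)
  have hcR : ((G.neighborFinset v ∩ S).card : ℝ) ≤ G.degree v := by exact_mod_cast hc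
  have hsplit : k.toNat = (k - G.degree v).toNat + G.degree v := by omega
  set d := G.degree v
  set c := (G.neighborFinset v ∩ S).card
  set ρ := (9 / 10 : ℝ) ^ (k - d).toNat with hρ
  have hρ0 : 0 ≤ ρ := by positivity
  have e1 : (9 / 10 : ℝ) ^ k.toNat = ρ * (9 / 10) ^ d := by rw [hsplit, pow_add]
  have e2 : (2 / 3 : ℝ) ^ d = (20 / 27) ^ d * (9 / 10) ^ d := by rw [← mul_pow]; norm_num
  have hη : errBound Q (k - d) = 8 + Q * ρ := rfl
  have hηk : errBound Q k = 8 + Q * (ρ * (9 / 10) ^ d) := by rw [← e1]; rfl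
  have hr : (0 : ℝ) < (9 / 10) ^ d := by positivity
  have hs : (0 : ℝ) < (2 / 3) ^ d := by positivity
  have hη0 : 0 ≤ errBound Q (k - d) := by rw [hη]; positivity
  have b2' : ((d : ℝ) - 1) * (2 / 3) ^ d ≤ (9 / 10) ^ d := by
    rw [e2, ← mul_assoc]
    exact mul_le_of_le_one_left hr.le b2
  have hQρ : 0 ≤ Q * ρ := by positivity
  have b4 := mul_le_mul_of_nonneg_right b2' hQρ
  refine ⟨h1, h2, h3.trans ?_, ?_⟩
  · have s1 : c * (4 / 3 * errBound Q (k - d)) * sinkRatio G S v ≤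
        d * (4 / 3 * errBound Q (k - d)) * (2 / 3) ^ d := by gcongr
    -- Uses 4d/3 ≤ 2(d-1), valid exactly for d ≥ 3; this yields the factor 2 of the general case.
    have s2 : (d : ℝ) * (4 / 3) * (2 / 3) ^ d ≤ 2 * (((d : ℝ) - 1) * (2 / 3) ^ d) := by
      nlinarith
    have s3 := mul_le_mul_of_nonneg_right s2 hη0
    rw [hηk]
    rw [hη] at *
    nlinarith
  · rintro ⟨w, hw, hwS⟩
    have hcd := card_neighborFinset_inter_le G hw hwS
    have hcd' : (c : ℝ) ≤ d - 1 := by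
      have : ((c + 1 : ℕ) : ℝ) ≤ d := by exact_mod_cast hcd
      push_cast at this
      linarith
    -- The missing neighbour saves a factor 3/4, which cancels the 4/3 from the divisions.
    have s0 : sinkRatio G S v ≤ 3 / 4 * (2 / 3) ^ d := by
      refine (sinkRatio_le G hdeg hv).trans ?_
      calc (1 / 2 : ℝ) ^ d * (4 / 3) ^ c = 3 / 4 * ((1 / 2 : ℝ) ^ d * (4 / 3) ^ (c + 1)) := by
            rw [pow_succ]; ring
        _ ≤ _ := by
            gcongr
            exact half_pow_mul_le_two_thirds hcd
    have s1 : c * (4 / 3 * errBound Q (k - d)) * sinkRatio G S v ≤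
        (d - 1) * (4 / 3 * errBound Q (k - d)) * (3 / 4 * (2 / 3) ^ d) := by
      have : (0 : ℝ) ≤ d - 1 := by linarith
      gcongr
    refine h3.trans ?_
    rw [hηk]
    rw [hη] at *
    nlinarith

end Ratio

/-! ### Timed Hoare triples -/

namespace WordRAM

infixr:60 " ;; " => Cmd.seq

variable {W : ℕ} {P : Program}

theorem runSteps_add (s t : ℕ) (σ : Config) :
    runSteps W P (s + t) σ = (runSteps W P s σ).bind (runSteps W P t) := by
  induction s generalizing σ with
  | zero => simp [runSteps]
  | succ s ih =>
    rw [Nat.add_right_comm]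
    simp only [runSteps]
    cases step W P σ <;> simp [ih]

/-- Started with registers `r` and memory `m`, the command `c` terminates after at most `b` steps,
with registers and memory that satisfy `Q`. -/
def Triple (W : ℕ) (P : Program) (c : Cmd) (r : ℕ → ℤ) (m : ℤ → ℤ) (b : ℝ)
    (Q : (ℕ → ℤ) → (ℤ → ℤ) → Prop) : Prop :=
  ∃ t : ℕ, (t : ℝ) ≤ b ∧ ∃ r' m', Q r' m' ∧
    ∀ K, runSteps W P t ⟨c :: K, r, m⟩ = some ⟨K, r', m'⟩

variable {r : ℕ → ℤ} {m : ℤ → ℤ} {b b' : ℝ} {Q Q' : (ℕ → ℤ) → (ℤ → ℤ) → Prop} {c d : Cmd}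

theorem Triple.mono (h : Triple W P c r m b Q) (hb : b ≤ b') (hQ : ∀ r m, Q r m → Q' r m) :
    Triple W P c r m b' Q' := by
  obtain ⟨t, ht, r', m', hq, hrun⟩ := h
  exact ⟨t, ht.trans hb, r', m', hQ _ _ hq, hrun⟩

theorem triple_skip (hb : 1 ≤ b) (hQ : Q r m) : Triple W P .skip r m b Q :=
  ⟨1, by simpa using hb, r, m, hQ, fun K => by simp [runSteps, step]⟩

theorem triple_const {x : ℕ} {z : ℤ} (hz : |z| ≤ W) (hb : 1 ≤ b)
    (hQ : Q (Function.update r x z) m) : Triple W P (.const x z) r m b Q :=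
  ⟨1, by simpa using hb, _, m, hQ, fun K => by simp [runSteps, step, setReg, hz]⟩

theorem triple_arith {op : Op} {x y₁ y₂ : ℕ} (z : ℤ) (h : op.eval (r y₁) (r y₂) = z)
    (hz : |z| ≤ W) (hb : 1 ≤ b) (hQ : Q (Function.update r x z) m) :
    Triple W P (.arith op x y₁ y₂) r m b Q :=
  ⟨1, by simpa using hb, _, m, hQ, fun K => by simp [runSteps, step, setReg, h, hz]⟩

theorem triple_load {x y : ℕ} (z : ℤ) (h : m (r y) = z) (hz : |z| ≤ W) (hb : 1 ≤ b)
    (hQ : Q (Function.update r x z) m) : Triple W P (.load x y) r m b Q :=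
  ⟨1, by simpa using hb, _, m, hQ, fun K => by simp [runSteps, step, setReg, h, hz]⟩

theorem triple_store {x y : ℕ} (a z : ℤ) (ha : r x = a) (h : r y = z) (hb : 1 ≤ b)
    (hQ : Q r (Function.update m a z)) : Triple W P (.store x y) r m b Q :=
  ⟨1, by simpa using hb, r, _, hQ, fun K => by simp [runSteps, step, h, ha]⟩

theorem triple_seq (b₁ : ℝ)
    (h : Triple W P c r m b₁ fun r' m' => Triple W P d r' m' (b - 1 - b₁) Q) :
    Triple W P (c ;; d) r m b Q := by
  obtain ⟨t, ht, r', m', ⟨t', ht', r'', m'', hq, hrun'⟩, hrun⟩ := h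
  refine ⟨1 + (t + t'), by push_cast; linarith, r'', m'', hq, fun K => ?_⟩
  rw [runSteps_add]
  simp [runSteps, step, runSteps_add, hrun, hrun']

/-- The 2 is one step for the sequencing and one for the command, here and in the next rules. -/
theorem triple_seq_const {x : ℕ} {z : ℤ} (hz : |z| ≤ W)
    (h : Triple W P d (Function.update r x z) m (b - 2) Q) :
    Triple W P (.const x z ;; d) r m b Q :=
  triple_seq 1 (triple_const hz le_rfl (by convert h using 1; ring))

theorem triple_seq_arith {op : Op} {x y₁ y₂ : ℕ} (z : ℤ) (hv : op.eval (r y₁) (r y₂) = z)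
    (hz : |z| ≤ W) (h : Triple W P d (Function.update r x z) m (b - 2) Q) :
    Triple W P (.arith op x y₁ y₂ ;; d) r m b Q :=
  triple_seq 1 (triple_arith z hv hz le_rfl (by convert h using 1; ring))

theorem triple_seq_load {x y : ℕ} (z : ℤ) (hv : m (r y) = z) (hz : |z| ≤ W)
    (h : Triple W P d (Function.update r x z) m (b - 2) Q) :
    Triple W P (.load x y ;; d) r m b Q :=
  triple_seq 1 (triple_load z hv hz le_rfl (by convert h using 1; ring))

theorem triple_seq_store {x y : ℕ} (a z : ℤ) (ha : r x = a) (hz : r y = z)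
    (h : Triple W P d r (Function.update m a z) (b - 2) Q) :
    Triple W P (.store x y ;; d) r m b Q :=
  triple_seq 1 (triple_store a z ha hz le_rfl (by convert h using 1; ring))

theorem triple_ifPos {x : ℕ} (h₁ : 0 < r x → Triple W P c r m (b - 1) Q)
    (h₂ : ¬ 0 < r x → Triple W P d r m (b - 1) Q) : Triple W P (.ifPos x c d) r m b Q := by
  have h : Triple W P (if 0 < r x then c else d) r m (b - 1) Q := by
    split_ifs with hx
    exacts [h₁ hx, h₂ hx]
  obtain ⟨t, ht, r', m', hq, hrun⟩ := h
  refine ⟨1 + t, by push_cast; linarith, r', m', hq, fun K => ?_⟩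
  rw [runSteps_add]
  simp [runSteps, step, hrun]

theorem triple_call {i : ℕ} (hc : P[i]? = some c) (h : Triple W P c r m (b - 1) Q) :
    Triple W P (.call i) r m b Q := by
  obtain ⟨t, ht, r', m', hq, hrun⟩ := h
  refine ⟨1 + t, by push_cast; linarith, r', m', hq, fun K => ?_⟩
  rw [runSteps_add]
  simp [runSteps, step, hrun, hc]

/-- A loop with invariant `I i` after `i` of `N` rounds. -/
theorem triple_while {x : ℕ} {N : ℕ} {β : ℝ} (I : ℕ → (ℕ → ℤ) → (ℤ → ℤ) → Prop)
    (hstep : ∀ i < N, ∀ r m, I i r m → 0 < r x ∧ Triple W P c r m β (I (i + 1)))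
    (hend : ∀ r m, I N r m → r x ≤ 0) (h₀ : I 0 r m) :
    Triple W P (.whilePos x c) r m (1 + N * (β + 1)) (I N) := by
  suffices H : ∀ j ≤ N, ∀ r m, I (N - j) r m →
      Triple W P (.whilePos x c) r m (1 + j * (β + 1)) (I N) from
    H N le_rfl r m (by simpa using h₀)
  intro j
  induction j with
  | zero =>
    intro _ r m h
    have hx := hend r m h
    exact ⟨1, by simp, r, m, h, fun K => by simp [runSteps, step, hx.not_gt]⟩
  | succ j ih =>
    intro hj r m h
    obtain ⟨hx, t, ht, r', m', hI, hrun⟩ := hstep (N - (j + 1)) (by omega) r m h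
    rw [show N - (j + 1) + 1 = N - j by omega] at hI
    obtain ⟨t', ht', r'', m'', hq, hrun'⟩ := ih (by omega) r' m' hI
    refine ⟨1 + (t + t'), by push_cast; linarith, r'', m'', hq, fun K => ?_⟩
    rw [runSteps_add]
    simp [runSteps, step, hx, runSteps_add, hrun, hrun']

/-- Add a number to a memory cell. -/
def bump (x : ℕ) (z : ℤ) : Cmd :=
  .load 17 x ;; .const 18 z ;; .arith .add 17 17 18 ;; .store x 17

theorem triple_seq_bump {x : ℕ} {z : ℤ} (a y : ℤ) (ha : r x = a) (hx : x ≠ 17 ∧ x ≠ 18)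
    (hy : m a = y) (hyW : |y| ≤ W) (hz : |z| ≤ W) (hyz : |y + z| ≤ W)
    (h : Triple W P d (Function.update (Function.update r 18 z) 17 (y + z))
      (Function.update m a (y + z)) (b - 8) Q) :
    Triple W P (bump x z ;; d) r m b Q := by
  refine triple_seq 7 ?_
  refine triple_seq_load y (by rw [ha, hy]) hyW ?_
  refine triple_seq_const hz ?_
  refine triple_seq_arith (y + z) (by simp [Op.eval]) hyz ?_
  refine triple_store a (y + z) (by simp [ha, hx]) (by simp) (by norm_num) ?_
  convert h using 1
  -- The loaded value in register 17 is overwritten by the sum, so only two register updates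
  -- survive.
  · ext i
    simp only [Function.update_apply]
    split_ifs <;> rfl
  · ring

end WordRAM

/-! ### The recursive procedure -/

namespace WordRAM

/-- Recursive evaluation of the neighbour whose number is in register `19`. -/
def nodeRecurse : Cmd :=
  .const 15 1 ;; .store 4 10 ;; .arith .add 4 4 15 ;; .store 4 11 ;; .arith .add 4 4 15 ;;
  .store 4 12 ;; .arith .add 4 4 15 ;; .store 4 14 ;; .arith .add 4 4 15 ;;
  .const 15 0 ;; .arith .add 10 19 15 ;; .call 1 ;;
  .const 15 1 ;; .arith .sub 4 4 15 ;; .load 14 4 ;; .arith .sub 4 4 15 ;; .load 12 4 ;;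
  .arith .sub 4 4 15 ;; .load 11 4 ;; .arith .sub 4 4 15 ;; .load 10 4 ;;
  .const 15 4 ;; .arith .add 15 10 15 ;; .load 13 15

/-- The second half of a round of the loop over the neighbours. -/
def nodeUpdate : Cmd :=
  .load 19 12 ;; .arith .add 20 3 19 ;; bump 20 1 ;;
  .arith .sub 22 2 0 ;; .arith .add 22 22 22 ;; .arith .mul 14 14 2 ;; .arith .div 14 14 22 ;;
  .const 15 1 ;; .arith .add 12 12 15 ;; .arith .sub 15 13 12

/-- One round of the loop over the neighbours. -/
def nodeBody : Cmd :=
  (.load 19 12 ;; .arith .add 20 3 19 ;; .load 21 20 ;; .const 0 0 ;; .const 22 1 ;;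
    .arith .sub 22 22 21 ;; .ifPos 22 nodeRecurse .skip) ;; nodeUpdate

/-- One round of the loop that removes the marks of the neighbours. -/
def nodeClean : Cmd :=
  .load 19 12 ;; .arith .add 20 3 19 ;; bump 20 (-1) ;;
  .const 15 1 ;; .arith .add 12 12 15 ;; .arith .sub 15 13 12

/-- Evaluation of a vertex whose budget is not exhausted. -/
def nodeExpand : Cmd :=
  (.arith .add 15 3 10 ;; bump 15 1 ;; .const 15 0 ;; .arith .add 14 2 15 ;;
    .arith .sub 15 13 12) ;;
  .whilePos 15 nodeBody ;;
  (.const 15 3 ;; .arith .add 15 10 15 ;; .load 12 15 ;; .arith .sub 15 13 12) ;;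
  .whilePos 15 nodeClean ;;
  (.arith .add 15 3 10 ;; bump 15 (-1) ;; .const 15 0 ;; .arith .add 0 14 15)

/-- Evaluation of the vertex in register `10` with the budget in register `11`. -/
def nodeProc : Cmd :=
  .const 15 3 ;; .arith .add 16 10 15 ;; .load 12 16 ;; .const 15 1 ;; .arith .add 16 16 15 ;;
  .load 13 16 ;; .arith .sub 15 13 12 ;; .arith .sub 11 11 15 ;; .const 15 1 ;;
  .arith .add 15 11 15 ;; .ifPos 15 nodeExpand (.const 0 0)

/-! ### Memory layout, and the counters that represent the current vertex set. -/

section Memory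

variable {n : ℕ} {L sp : ℤ} {X : Finset (Fin n)} {m₀ m : ℤ → ℤ}

/-- The memory holds the adjacency lists at the addresses `off v`. -/
structure Layout (adj : Fin n → List (Fin n)) (off : Fin n → ℤ) (L : ℤ) (m : ℤ → ℤ) : Prop where
  start : ∀ v : Fin n, m ((v : ℕ) + 3) = off v
  finish : ∀ v : Fin n, m ((v : ℕ) + 4) = off v + (adj v).length
  entry : ∀ (v : Fin n) (i : ℕ) (h : i < (adj v).length), m (off v + i) = ((adj v)[i] : ℕ)
  low : ∀ v, (n : ℤ) + 4 ≤ off v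
  high : ∀ v, off v + (adj v).length ≤ L

/-- Below `sp`, the memory `m` differs from `m₀` in that the counters of the vertices in `X` have
been increased by one. -/
def Marked (L sp : ℤ) (X : Finset (Fin n)) (m₀ m : ℤ → ℤ) : Prop :=
  ∀ x < sp, m x = m₀ x + if ∃ u ∈ X, x = L + (u : ℕ) then 1 else 0

theorem Marked.empty : Marked L sp (∅ : Finset (Fin n)) m m := fun x _ => by simp

theorem Marked.eq (h : Marked L sp (∅ : Finset (Fin n)) m₀ m) {x : ℤ} (hx : x < sp) :
    m x = m₀ x := by
  simpa using h x hx

theorem Marked.low (h : Marked L sp X m₀ m) {x : ℤ} (hx : x < sp) (hL : x < L) : m x = m₀ x := by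
  rw [h x hx, if_neg, add_zero]
  rintro ⟨u, -, hu⟩
  omega

theorem Marked.mark (h : Marked L sp X m₀ m) (hsp : L + n ≤ sp) (u : Fin n) :
    m (L + (u : ℕ)) = m₀ (L + (u : ℕ)) + if u ∈ X then 1 else 0 := by
  have hu := u.2
  rw [h _ (by omega)]
  congr 2
  refine propext ⟨?_, fun hu => ⟨u, hu, rfl⟩⟩
  rintro ⟨w, hw, he⟩
  have : w = u := Fin.ext (by omega)
  exact this ▸ hw

theorem Marked.congr (h : Marked L sp X m₀ m) {m' : ℤ → ℤ} (h' : ∀ x < sp, m' x = m x) :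
    Marked L sp X m₀ m' := fun x hx => (h' x hx).trans (h x hx)

theorem Marked.insert (h : Marked L sp X m₀ m) {u : Fin n} (hu : u ∉ X) :
    Marked L sp (insert u X) m₀
      (Function.update m (L + (u : ℕ)) (m (L + (u : ℕ)) + 1)) := by
  intro x hx
  by_cases hxu : x = L + (u : ℕ)
  · subst hxu
    have : ¬ ∃ w ∈ X, L + (u : ℕ) = L + (w : ℕ) := by
      rintro ⟨w, hw, he⟩
      have : w = u := Fin.ext (by omega)
      exact hu (this ▸ hw)
    rw [Function.update_self, h _ hx, if_neg this, if_pos ⟨u, by simp, rfl⟩, add_zero]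
  · rw [Function.update_of_ne hxu, h x hx]
    simp [hxu]

theorem Marked.erase (h : Marked L sp X m₀ m) {u : Fin n} (hu : u ∈ X) :
    Marked L sp (X.erase u) m₀
      (Function.update m (L + (u : ℕ)) (m (L + (u : ℕ)) + (-1))) := by
  intro x hx
  by_cases hxu : x = L + (u : ℕ)
  · subst hxu
    have : ¬ ∃ w ∈ X.erase u, L + (u : ℕ) = L + (w : ℕ) := by
      rintro ⟨w, hw, he⟩
      have : w = u := Fin.ext (by omega)
      exact (Finset.mem_erase.1 hw).1 this
    rw [Function.update_self, h _ hx, if_neg this, if_pos ⟨u, hu, rfl⟩]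
    ring
  · rw [Function.update_of_ne hxu, h x hx]
    congr 2
    refine propext ⟨fun ⟨w, hw, he⟩ => ⟨w, Finset.mem_erase.2 ⟨?_, hw⟩, he⟩,
      fun ⟨w, hw, he⟩ => ⟨w, Finset.mem_of_mem_erase hw, he⟩⟩
    rintro rfl
    exact hxu he

variable {adj : Fin n → List (Fin n)} {off : Fin n → ℤ}

theorem Layout.congr (h : Layout adj off L m₀) (h' : ∀ x < L, m x = m₀ x) :
    Layout adj off L m where
  start v := by
    have := v.2
    have := h.low v
    have := h.high v
    rw [h' _ (by omega), h.start]
  finish v := by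
    have := v.2
    have := h.low v
    have := h.high v
    rw [h' _ (by omega), h.finish]
  entry v i hi := by
    have := h.high v
    rw [h' _ (by omega), h.entry v i hi]
  low := h.low
  high := h.high

end Memory

/-! ### Preconditions and invariants of the recursive evaluation. -/

variable {n : ℕ}

/-- The word bound suffices for the scaling factor `Q`, counters up to `MB` and addresses up to
`SB`. -/
structure Bounds (W : ℕ) (Q MB SB : ℤ) : Prop where
  pos : 0 < Q
  sq : 2 * Q * Q ≤ W
  mb : MB ≤ W
  sb : SB ≤ W
  hundred : 100 ≤ W

/-- The machine is ready to evaluate a vertex of `S` with budget `k` and stack pointer `sp`. -/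
structure Ready (adj : Fin n → List (Fin n)) (off : Fin n → ℤ) (L Q MB SB : ℤ)
    (S : Finset (Fin n)) (k sp : ℤ) (r : ℕ → ℤ) (m : ℤ → ℤ) : Prop where
  layout : Layout adj off L m
  marks : ∀ u : Fin n, 0 ≤ m (L + (u : ℕ)) ∧ (m (L + (u : ℕ)) = 0 ↔ u ∈ S) ∧
    m (L + (u : ℕ)) + k ≤ MB
  rQ : r 2 = Q
  rL : r 3 = L
  rsp : r 4 = sp
  le_sp : L + n ≤ sp
  budget : 0 ≤ k
  stack : sp + 4 * k ≤ SB

section Node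

variable {W : ℕ} {P : Program} (G : SimpleGraph (Fin n)) [DecidableRel G.Adj]

/-- The result of the evaluation of the vertex `v` of `S`. -/
def NodePost (Q k sp : ℤ) (S : Finset (Fin n)) (v : Fin n) (r : ℕ → ℤ) (m : ℤ → ℤ)
    (r' : ℕ → ℤ) (m' : ℤ → ℤ) : Prop :=
  ApproxRatio G Q k S v (r' 0) ∧ (∀ x, 1 ≤ x → x < 10 → r' x = r x) ∧ ∀ x < sp, m' x = m x

/-- The state in the evaluation of `v`, after `i` neighbours; `r₀` and `m₀` are the registers and
the memory at the start. -/
structure LoopInv (adj : Fin n → List (Fin n)) (off : Fin n → ℤ) (L Q k sp : ℤ)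
    (S : Finset (Fin n)) (v : Fin n) (r₀ : ℕ → ℤ) (m₀ : ℤ → ℤ) (i : ℕ)
    (r : ℕ → ℤ) (m : ℤ → ℤ) : Prop where
  r10 : r 10 = (v : ℕ)
  r11 : r 11 = k
  r12 : r 12 = off v + i
  r13 : r 13 = off v + (adj v).length
  keep : ∀ x, 1 ≤ x → x < 10 → r x = r₀ x
  le_Q : r 14 ≤ Q
  mem : Marked L sp (insert v ((adj v).take i).toFinset) m₀ m
  fold : ApproxFold G Q (errBound Q k) (S.erase v) (S \ insert v ((adj v).take i).toFinset) i
    (((adj v).take i).toFinset ∩ S).card (r 14)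

variable {adj : Fin n → List (Fin n)} {off : Fin n → ℤ} {L Q MB SB : ℤ} {S : Finset (Fin n)}
  {k sp : ℤ} {v : Fin n} {r₀ r : ℕ → ℤ} {m₀ m : ℤ → ℤ}

theorem keep_update {r r₀ : ℕ → ℤ} (h : ∀ x, 1 ≤ x → x < 10 → r x = r₀ x) {y : ℕ} (hy : 10 ≤ y)
    (z : ℤ) : ∀ x, 1 ≤ x → x < 10 → Function.update r y z x = r₀ x := fun x h1 h2 => by
  rw [Function.update_of_ne (by omega), h x h1 h2]

theorem keep_update_zero {r r₀ : ℕ → ℤ} (h : ∀ x, 1 ≤ x → x < 10 → r x = r₀ x)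
    (z : ℤ) : ∀ x, 1 ≤ x → x < 10 → Function.update r 0 z x = r₀ x := fun x h1 h2 => by
  rw [Function.update_of_ne (by omega), h x h1 h2]

theorem length_eq_degree (hadj : IsAdjacencyLists G adj) (v : Fin n) :
    (adj v).length = G.degree v := by
  rw [← List.toFinset_card_of_nodup (hadj v).1, ← G.card_neighborFinset_eq_degree]
  congr 1
  ext w
  simp [(hadj v).2]

end Node

end WordRAM

/-! ### One round of the loop over the neighbours. -/

namespace WordRAM

section Node

variable {n : ℕ} {W : ℕ} {P : Program} (G : SimpleGraph (Fin n)) [DecidableRel G.Adj]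
variable {adj : Fin n → List (Fin n)} {off : Fin n → ℤ} {L Q MB SB : ℤ} {S : Finset (Fin n)}
  {k sp : ℤ} {v : Fin n} {r₀ r : ℕ → ℤ} {m₀ m : ℤ → ℤ}

omit [DecidableRel G.Adj] in
-- The callee preserves only registers 1 to 9 and the cells below its stack pointer. Hence registers
-- 10, 11, 12 and 14 (vertex, budget, list position, accumulator) are saved in four cells at `sp`,
-- while register 13 is read again from the address table. One level of recursion raises a counter
-- by at most 1 and the stack by 4, while the budget drops by at least 3, so the bounds in `Ready`
-- persist.
theorem nodeRecurse_spec (hB : Bounds W Q MB SB) (hP : P[1]? = some nodeProc)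
    (hR : Ready adj off L Q MB SB S (k + (adj v).length) sp r₀ m₀) (hk : 0 ≤ k)
    (hd : 3 ≤ (adj v).length) {i : ℕ} {u : Fin n}
    (hI : LoopInv G adj off L Q k sp S v r₀ m₀ i r m) (hi : i < (adj v).length)
    (hu : r 19 = (u : ℕ)) (huS : u ∈ S \ insert v ((adj v).take i).toFinset) {β : ℝ}
    (IH : ∀ (S' : Finset (Fin n)) (u : Fin n) (sp' : ℤ) (r : ℕ → ℤ) (m : ℤ → ℤ),
      Ready adj off L Q MB SB S' k sp' r m → u ∈ S' → r 10 = (u : ℕ) → r 11 = k →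
        Triple W P nodeProc r m β (NodePost G Q k sp' S' u r m)) :
    Triple W P nodeRecurse r m (β + 60) fun r' m' =>
      LoopInv G adj off L Q k sp S v r₀ m₀ i r' m' ∧
        ApproxRatio G Q k (S \ insert v ((adj v).take i).toFinset) u (r' 0) := by
  have h4 : r 4 = sp := (hI.keep 4 (by norm_num) (by norm_num)).trans hR.rsp
  have h2 : r 2 = Q := (hI.keep 2 (by norm_num) (by norm_num)).trans hR.rQ
  have h3 : r 3 = L := (hI.keep 3 (by norm_num) (by norm_num)).trans hR.rL
  obtain ⟨h10, h11, h12, h13, hkeep, hTQ, hmem, hfold⟩ := hI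
  have hT0 := hfold.1
  have hvn := v.2
  have hun := u.2
  have b1 := hR.layout.low v
  have b2 := hR.layout.high v
  have b3 := hR.le_sp
  have b4 := hR.stack
  have b5 := hB.sb
  have b6 := hB.hundred
  have b7 : Q ≤ W := by nlinarith [hB.sq, hB.pos]
  unfold nodeRecurse
  refine triple_seq_const (abs_le.2 ⟨by omega, by omega⟩) ?_
  refine triple_seq_store sp (v : ℕ) (by simp [h4]) (by simp [h10]) ?_
  refine triple_seq_arith (sp + 1) (by simp [Op.eval, h4]) (abs_le.2 ⟨by omega, by omega⟩) ?_
  refine triple_seq_store (sp + 1) k (by simp) (by simp [h11]) ?_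
  refine triple_seq_arith (sp + 2) (by simp [Op.eval]; ring) (abs_le.2 ⟨by omega, by omega⟩) ?_
  refine triple_seq_store (sp + 2) (off v + i) (by simp) (by simp [h12]) ?_
  refine triple_seq_arith (sp + 3) (by simp [Op.eval]; ring) (abs_le.2 ⟨by omega, by omega⟩) ?_
  refine triple_seq_store (sp + 3) (r 14) (by simp) (by simp) ?_
  refine triple_seq_arith (sp + 4) (by simp [Op.eval]; ring) (abs_le.2 ⟨by omega, by omega⟩) ?_
  refine triple_seq_const (by simp) ?_
  refine triple_seq_arith (u : ℕ) (by simp [Op.eval, hu]) (abs_le.2 ⟨by omega, by omega⟩) ?_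
  set R := Function.update (Function.update (Function.update (Function.update (Function.update
    (Function.update (Function.update r 15 1) 4 (sp + 1)) 4 (sp + 2)) 4 (sp + 3)) 4 (sp + 4))
    15 0) 10 ((u : ℕ) : ℤ) with hRdef
  set M := Function.update (Function.update (Function.update (Function.update m sp ((v : ℕ) : ℤ))
    (sp + 1) k) (sp + 2) (off v + i)) (sp + 3) (r 14) with hMdef
  have hM : ∀ x < sp, M x = m x := by
    intro x hx
    rw [hMdef, Function.update_of_ne (by omega), Function.update_of_ne (by omega),
      Function.update_of_ne (by omega), Function.update_of_ne (by omega)]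
  have hMm : Marked L sp (insert v ((adj v).take i).toFinset) m₀ M := hmem.congr hM
  have hready : Ready adj off L Q MB SB (S \ insert v ((adj v).take i).toFinset) k (sp + 4)
      R M := by
    refine ⟨hR.layout.congr fun x hx => hMm.low (by omega) hx, fun w => ?_, by simp [R, h2],
      by simp [R, h3], by simp [R], by omega, hk, by omega⟩
    obtain ⟨w1, w2, w3⟩ := hR.marks w
    rw [hMm.mark hR.le_sp]
    rw [Finset.mem_sdiff, ← w2]
    split_ifs with hw
    · exact ⟨by omega, ⟨fun _ => by omega, fun h => absurd hw h.2⟩, by omega⟩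
    · exact ⟨by omega, ⟨fun h => ⟨by omega, hw⟩, fun h => by omega⟩, by omega⟩
  refine triple_seq (β + 1) (triple_call hP (Triple.mono
    (IH _ u (sp + 4) R M hready huS (by simp [R]) (by simp [R, h11])) (by ring_nf; rfl) ?_))
  rintro r' m' ⟨hA, hk', hm'⟩
  have hr4 : r' 4 = sp + 4 := by rw [hk' 4 (by norm_num) (by norm_num)]; simp [R]
  have e0 : m' sp = (v : ℕ) := by
    rw [hm' _ (by omega), hMdef, Function.update_of_ne (by omega), Function.update_of_ne (by omega),
      Function.update_of_ne (by omega), Function.update_self]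
  have e1 : m' (sp + 1) = k := by
    rw [hm' _ (by omega), hMdef, Function.update_of_ne (by omega), Function.update_of_ne (by omega),
      Function.update_self]
  have e2 : m' (sp + 2) = off v + i := by
    rw [hm' _ (by omega), hMdef, Function.update_of_ne (by omega), Function.update_self]
  have e3 : m' (sp + 3) = r 14 := by
    rw [hm' _ (by omega), hMdef, Function.update_self]
  have hm'' : Marked L sp (insert v ((adj v).take i).toFinset) m₀ m' :=
    hMm.congr fun x hx => hm' x (by omega)
  have hlay := hR.layout.congr (m := m') fun x hx => hm''.low (by omega) hx
  refine triple_seq_const (abs_le.2 ⟨by omega, by omega⟩) ?_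
  refine triple_seq_arith (sp + 3) (by simp [Op.eval, hr4]; ring)
    (abs_le.2 ⟨by omega, by omega⟩) ?_
  refine triple_seq_load (r 14) (by simp [e3]) (abs_le.2 ⟨by omega, by omega⟩) ?_
  refine triple_seq_arith (sp + 2) (by simp [Op.eval]; ring) (abs_le.2 ⟨by omega, by omega⟩) ?_
  refine triple_seq_load (off v + i) (by simp [e2]) (abs_le.2 ⟨by omega, by omega⟩) ?_
  refine triple_seq_arith (sp + 1) (by simp [Op.eval]; ring) (abs_le.2 ⟨by omega, by omega⟩) ?_
  refine triple_seq_load k (by simp [e1]) (abs_le.2 ⟨by omega, by omega⟩) ?_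
  refine triple_seq_arith sp (by simp [Op.eval]) (abs_le.2 ⟨by omega, by omega⟩) ?_
  refine triple_seq_load (v : ℕ) (by simp [e0]) (abs_le.2 ⟨by omega, by omega⟩) ?_
  refine triple_seq_const (abs_le.2 ⟨by omega, by omega⟩) ?_
  refine triple_seq_arith ((v : ℕ) + 4) (by simp [Op.eval]) (abs_le.2 ⟨by omega, by omega⟩) ?_
  refine triple_load (off v + (adj v).length) (by simp [hlay.finish])
    (abs_le.2 ⟨by omega, by omega⟩) (by ring_nf; norm_num) ?_
  refine ⟨⟨by simp, by simp, by simp, by simp, ?_, by simpa using hTQ, hm'', by simpa using hfold⟩,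
    by simpa using hA⟩
  intro x hx1 hx2
  by_cases hx4 : x = 4
  · subst hx4
    simp [hR.rsp]
  · have : R x = r x := by
      simp only [R]
      repeat rw [Function.update_of_ne (by omega)]
    repeat rw [Function.update_of_ne (by omega)]
    rw [hk' x hx1 hx2, this, hkeep x hx1 hx2]

theorem nodeUpdate_spec (hdeg : ∀ v, 3 ≤ G.degree v) (hadj : IsAdjacencyLists G adj)
    (hB : Bounds W Q MB SB)
    (hR : Ready adj off L Q MB SB S (k + (adj v).length) sp r₀ m₀) (hk : 0 ≤ k)
    {i : ℕ} (hI : LoopInv G adj off L Q k sp S v r₀ m₀ i r m) (hi : i < (adj v).length)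
    (hA : ((adj v)[i] ∉ S \ insert v ((adj v).take i).toFinset ∧ r 0 = 0) ∨
      ((adj v)[i] ∈ S \ insert v ((adj v).take i).toFinset ∧
        ApproxRatio G Q k (S \ insert v ((adj v).take i).toFinset) (adj v)[i] (r 0))) :
    Triple W P nodeUpdate r m 60 fun r' m' =>
      LoopInv G adj off L Q k sp S v r₀ m₀ (i + 1) r' m' ∧
        r' 15 = (adj v).length - (i + 1 : ℕ) := by
  have h2 : r 2 = Q := (hI.keep 2 (by norm_num) (by norm_num)).trans hR.rQ
  have h3 : r 3 = L := (hI.keep 3 (by norm_num) (by norm_num)).trans hR.rL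
  obtain ⟨h10, h11, h12, h13, hkeep, hTQ, hmem, hfold⟩ := hI
  have hT0 := hfold.1
  obtain ⟨hnodup, hmemadj⟩ := hadj v
  obtain ⟨u, hu⟩ : ∃ u, u = (adj v)[i] := ⟨_, rfl⟩
  rw [← hu] at hA
  have huv : G.Adj v u := (hmemadj u).1 (hu ▸ List.getElem_mem hi)
  have hvS : v ∉ S \ insert v ((adj v).take i).toFinset := by simp
  -- The list has no repetitions, so this level has not marked `u` yet and its counter grows by
  -- exactly 1 in all.
  have hutake : u ∉ (adj v).take i := by
    intro hmem'
    obtain ⟨j, hj, hju⟩ := List.getElem_of_mem hmem'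
    rw [List.length_take] at hj
    rw [List.getElem_take, hu] at hju
    have := (hnodup.getElem_inj_iff (hi := by omega) (hj := by omega)).1 hju
    omega
  have htake : ((adj v).take (i + 1)).toFinset = insert u ((adj v).take i).toFinset := by
    ext w
    rw [List.take_succ_eq_append_getElem hi, ← hu]
    simp
  have hstep := approxFold_step G hdeg hB.pos huv.symm hvS hfold hA
  have hA0 : 0 ≤ r 0 := by
    rcases hA with ⟨-, h⟩ | ⟨-, h⟩
    exacts [h.ge, h.1]
  -- The bound 1/4 keeps the divisor 2(Q - A) at least Q, so the accumulator never grows beyond Q.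
  have hA4 : 4 * r 0 ≤ Q := by
    rcases hA with ⟨-, h⟩ | ⟨-, h⟩
    · rw [h]; linarith [hB.pos]
    · have h1 := h.2.1
      have h2 := sinkRatio_le_quarter G hdeg huv.symm hvS
      have hQ' : (0 : ℝ) < Q := by exact_mod_cast hB.pos
      have : (4 : ℝ) * r 0 ≤ Q := by nlinarith
      exact_mod_cast this
  obtain ⟨w1, w2, w3⟩ := hR.marks u
  have hmu := hmem.mark hR.le_sp u
  rw [if_neg (by simp [hutake, huv.ne'])] at hmu
  have hlay := hR.layout.congr (m := m) fun x hx => hmem.low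
    (by have := hR.le_sp; omega) hx
  have hent := hlay.entry v i hi
  rw [← hu] at hent
  have hun := u.2
  have b1 := hR.layout.low v
  have b2 := hR.layout.high v
  have b3 := hR.le_sp
  have b4 := hR.stack
  have b5 := hB.sb
  have b6 := hB.hundred
  have b7 := hB.mb
  have b8 := hB.pos
  have b9 := hB.sq
  have b10 : r 14 * Q ≤ Q * Q := by nlinarith
  have b11 : 0 ≤ r 14 * Q := by positivity
  have b12 : 2 * Q ≤ W := by nlinarith
  have hdle : r 14 * Q / (2 * (Q - r 0)) ≤ r 14 := by
    refine Int.ediv_le_of_le_mul (by omega) ?_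
    exact mul_le_mul_of_nonneg_left (by omega) hT0
  have hd0 : 0 ≤ r 14 * Q / (2 * (Q - r 0)) := hstep.1
  have hbe : (2 * Q * Q : ℤ) = 2 * (Q * Q) := by ring
  have hr4 : r 4 = r₀ 4 := hkeep 4 (by norm_num) (by norm_num)
  unfold nodeUpdate
  refine triple_seq_load (u : ℕ) (by rw [h12, hent]) (abs_le.2 ⟨by omega, by omega⟩) ?_
  refine triple_seq_arith (L + (u : ℕ)) (by simp [Op.eval, h3])
    (abs_le.2 ⟨by omega, by omega⟩) ?_
  refine triple_seq_bump (L + (u : ℕ)) (m (L + (u : ℕ))) (by simp) (by simp) rfl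
    (abs_le.2 ⟨by omega, by omega⟩) (abs_le.2 ⟨by omega, by omega⟩)
    (abs_le.2 ⟨by omega, by omega⟩) ?_
  refine triple_seq_arith (Q - r 0) (by simp [Op.eval, h2]) (abs_le.2 ⟨by omega, by omega⟩) ?_
  refine triple_seq_arith (2 * (Q - r 0)) (by simp [Op.eval]; ring)
    (abs_le.2 ⟨by omega, by omega⟩) ?_
  refine triple_seq_arith (r 14 * Q) (by simp [Op.eval, h2])
    (abs_le.2 ⟨by linarith, by linarith⟩) ?_
  refine triple_seq_arith (r 14 * Q / (2 * (Q - r 0))) (by simp [Op.eval])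
    (abs_le.2 ⟨by linarith, by linarith⟩) ?_
  refine triple_seq_const (abs_le.2 ⟨by omega, by omega⟩) ?_
  refine triple_seq_arith (off v + (i + 1 : ℕ)) (by simp [Op.eval, h12]; ring)
    (abs_le.2 ⟨by omega, by omega⟩) ?_
  refine triple_arith ((adj v).length - (i + 1 : ℕ)) (by simp [Op.eval, h13])
    (abs_le.2 ⟨by omega, by omega⟩) (by norm_num) ?_
  refine ⟨⟨by simp [h10], by simp [h11], by simp, by simp [h13], ?_, ?_, ?_, ?_⟩, by simp⟩
  · repeat refine keep_update ?_ (by norm_num) _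
    exact hkeep
  · simpa using hdle.trans hTQ
  · rw [htake, Finset.insert_comm]
    exact hmem.insert (by simp [hutake, huv.ne'])
  · have e1 : S \ insert v ((adj v).take (i + 1)).toFinset =
        (S \ insert v ((adj v).take i).toFinset).erase u := by
      rw [htake, Finset.insert_comm, Finset.sdiff_insert]
    have e2 : (((adj v).take (i + 1)).toFinset ∩ S).card =
        if u ∈ S \ insert v ((adj v).take i).toFinset then
          (((adj v).take i).toFinset ∩ S).card + 1 else (((adj v).take i).toFinset ∩ S).card := by
      rw [htake]
      by_cases huS : u ∈ S
      · rw [if_pos (by simp [huS, huv.ne', hutake]), Finset.insert_inter_of_mem huS,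
          Finset.card_insert_of_notMem (by simp [hutake])]
      · rw [if_neg (by simp [huS]), Finset.insert_inter_of_notMem huS]
    rw [e1, e2]
    simpa using hstep

theorem nodeBody_spec (hdeg : ∀ v, 3 ≤ G.degree v) (hadj : IsAdjacencyLists G adj)
    (hB : Bounds W Q MB SB) (hP : P[1]? = some nodeProc)
    (hR : Ready adj off L Q MB SB S (k + (adj v).length) sp r₀ m₀) (hk : 0 ≤ k)
    {i : ℕ} (hI : LoopInv G adj off L Q k sp S v r₀ m₀ i r m) (hi : i < (adj v).length)
    {β : ℝ} (hβ : 0 ≤ β)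
    (IH : ∀ (S' : Finset (Fin n)) (u : Fin n) (sp' : ℤ) (r : ℕ → ℤ) (m : ℤ → ℤ),
      Ready adj off L Q MB SB S' k sp' r m → u ∈ S' → r 10 = (u : ℕ) → r 11 = k →
        Triple W P nodeProc r m β (NodePost G Q k sp' S' u r m)) :
    Triple W P nodeBody r m (β + 150) fun r' m' =>
      LoopInv G adj off L Q k sp S v r₀ m₀ (i + 1) r' m' ∧
        r' 15 = (adj v).length - (i + 1 : ℕ) := by
  have h3 : r 3 = L := (hI.keep 3 (by norm_num) (by norm_num)).trans hR.rL
  have hmem := hI.mem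
  have hd : 3 ≤ (adj v).length := by rw [length_eq_degree G hadj]; exact hdeg v
  obtain ⟨u, hu⟩ : ∃ u, u = (adj v)[i] := ⟨_, rfl⟩
  have huv : G.Adj v u := ((hadj v).2 u).1 (hu ▸ List.getElem_mem hi)
  obtain ⟨w1, w2, w3⟩ := hR.marks u
  have hmu := hmem.mark hR.le_sp u
  have hlay := hR.layout.congr (m := m) fun x hx => hmem.low
    (by have := hR.le_sp; omega) hx
  have hent := hlay.entry v i hi
  rw [← hu] at hent
  have hun := u.2
  have b1 := hR.layout.low v
  have b2 := hR.layout.high v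
  have b3 := hR.le_sp
  have b4 := hR.stack
  have b5 := hB.sb
  have b6 := hB.hundred
  have b7 := hB.mb
  -- A vertex is in the current set exactly if its counter is 0; the test 1 - counter > 0 detects
  -- this because counters are nonnegative.
  have hz : 0 ≤ m (L + (u : ℕ)) ∧ m (L + (u : ℕ)) ≤ W ∧
      (0 < 1 - m (L + (u : ℕ)) ↔ u ∈ S \ insert v ((adj v).take i).toFinset) := by
    rw [Finset.mem_sdiff, ← w2]
    split_ifs at hmu with hw
    · exact ⟨by omega, by omega, fun h => by omega, fun h => absurd hw h.2⟩
    · exact ⟨by omega, by omega, fun h => ⟨by omega, hw⟩, fun h => by omega⟩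
  obtain ⟨z1, z2, z3⟩ := hz
  -- The invariant does not depend on register 0 or on the scratch registers from 15 on.
  have key : ∀ (r' : ℕ → ℤ), (∀ x, 1 ≤ x → x < 15 → r' x = r x) →
      LoopInv G adj off L Q k sp S v r₀ m₀ i r' m := by
    intro r' hr'
    exact ⟨by rw [hr' _ (by norm_num) (by norm_num), hI.r10],
      by rw [hr' _ (by norm_num) (by norm_num), hI.r11],
      by rw [hr' _ (by norm_num) (by norm_num), hI.r12],
      by rw [hr' _ (by norm_num) (by norm_num), hI.r13],
      fun x h1 h2 => by rw [hr' x h1 (by omega), hI.keep x h1 h2],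
      by rw [hr' _ (by norm_num) (by norm_num)]; exact hI.le_Q, hmem,
      by rw [hr' _ (by norm_num) (by norm_num)]; exact hI.fold⟩
  unfold nodeBody
  refine triple_seq (β + 80) ?_
  refine triple_seq_load (u : ℕ) (by rw [hI.r12, hent]) (abs_le.2 ⟨by omega, by omega⟩) ?_
  refine triple_seq_arith (L + (u : ℕ)) (by simp [Op.eval, h3])
    (abs_le.2 ⟨by omega, by omega⟩) ?_
  refine triple_seq_load (m (L + (u : ℕ))) (by simp) (abs_le.2 ⟨by omega, by omega⟩) ?_
  -- Register 0 is preset to 0, the exact ratio of a neighbour outside the current set, in case no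
  -- call is made.
  refine triple_seq_const (by simp) ?_
  refine triple_seq_const (abs_le.2 ⟨by omega, by omega⟩) ?_
  refine triple_seq_arith (1 - m (L + (u : ℕ))) (by simp [Op.eval])
    (abs_le.2 ⟨by omega, by omega⟩) ?_
  have hkey := key (Function.update (Function.update (Function.update (Function.update
    (Function.update (Function.update r 19 ((u : ℕ) : ℤ)) 20 (L + (u : ℕ))) 21
      (m (L + (u : ℕ)))) 0 0) 22 1) 22 (1 - m (L + (u : ℕ)))) (by
      intro x h1 h2
      repeat rw [Function.update_of_ne (by omega)])
  refine triple_ifPos (fun h => ?_) (fun h => ?_)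
  · have h' : u ∈ S \ insert v ((adj v).take i).toFinset := by
      rw [← z3]
      simpa using h
    refine (nodeRecurse_spec G hB hP hR hk hd hkey hi (by simp) h' IH).mono
      (by linarith) fun r' m' hr' => ?_
    refine (nodeUpdate_spec G hdeg hadj hB hR hk hr'.1 hi (Or.inr ?_)).mono
      (by linarith) fun _ _ h => h
    rw [← hu]
    exact ⟨h', hr'.2⟩
  · have h' : u ∉ S \ insert v ((adj v).take i).toFinset := by
      rw [← z3]
      simpa using h
    refine triple_skip (by linarith) ?_
    refine (nodeUpdate_spec G hdeg hadj hB hR hk hkey hi (Or.inl ?_)).mono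
      (by linarith) fun _ _ h => h
    rw [← hu]
    exact ⟨h', by simp⟩

end Node

end WordRAM

/-! ### Removal of the marks; correctness and cost of the recursion. -/

namespace WordRAM

section Node

variable {n : ℕ} {W : ℕ} {P : Program} (G : SimpleGraph (Fin n)) [DecidableRel G.Adj]
variable {adj : Fin n → List (Fin n)} {off : Fin n → ℤ} {L Q MB SB : ℤ} {S : Finset (Fin n)}
  {k sp : ℤ} {v : Fin n} {r₀ r : ℕ → ℤ} {m₀ m : ℤ → ℤ}

/-- The state after the removal of the marks of `i` neighbours. -/
structure CleanInv (adj : Fin n → List (Fin n)) (off : Fin n → ℤ) (L sp T : ℤ) (v : Fin n)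
    (r₀ : ℕ → ℤ) (m₀ : ℤ → ℤ) (i : ℕ) (r : ℕ → ℤ) (m : ℤ → ℤ) : Prop where
  r10 : r 10 = (v : ℕ)
  r12 : r 12 = off v + i
  r13 : r 13 = off v + (adj v).length
  r14 : r 14 = T
  r15 : r 15 = (adj v).length - i
  keep : ∀ x, 1 ≤ x → x < 10 → r x = r₀ x
  mem : Marked L sp (insert v ((adj v).drop i).toFinset) m₀ m

omit [DecidableRel G.Adj] in
theorem nodeClean_spec (hadj : IsAdjacencyLists G adj) (hB : Bounds W Q MB SB)
    (hR : Ready adj off L Q MB SB S k sp r₀ m₀) (hk : 1 ≤ k) {T : ℤ}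
    {i : ℕ} (hI : CleanInv adj off L sp T v r₀ m₀ i r m) (hi : i < (adj v).length) :
    Triple W P nodeClean r m 50 (CleanInv adj off L sp T v r₀ m₀ (i + 1)) := by
  have h3 : r 3 = L := (hI.keep 3 (by norm_num) (by norm_num)).trans hR.rL
  obtain ⟨h10, h12, h13, h14, h15, hkeep, hmem⟩ := hI
  obtain ⟨hnodup, hmemadj⟩ := hadj v
  obtain ⟨u, hu⟩ : ∃ u, u = (adj v)[i] := ⟨_, rfl⟩
  have huv : G.Adj v u := (hmemadj u).1 (hu ▸ List.getElem_mem hi)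
  have hdrop : (adj v).drop i = u :: (adj v).drop (i + 1) := by
    rw [hu, List.drop_eq_getElem_cons hi]
  have hudrop : u ∉ (adj v).drop (i + 1) := by
    have := hnodup.sublist (List.drop_sublist i (adj v))
    rw [hdrop] at this
    exact (List.nodup_cons.1 this).1
  have hset : (insert v ((adj v).drop i).toFinset).erase u =
      insert v ((adj v).drop (i + 1)).toFinset := by
    rw [Finset.erase_insert_of_ne huv.ne, hdrop, List.toFinset_cons,
      Finset.erase_insert (by simpa using hudrop)]
  have huX : u ∈ insert v ((adj v).drop i).toFinset := by simp [hdrop]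
  obtain ⟨w1, w2, w3⟩ := hR.marks u
  have hmu := hmem.mark hR.le_sp u
  rw [if_pos huX] at hmu
  have hlay := hR.layout.congr (m := m) fun x hx => hmem.low
    (by have := hR.le_sp; omega) hx
  have hent := hlay.entry v i hi
  rw [← hu] at hent
  have hun := u.2
  have b1 := hR.layout.low v
  have b2 := hR.layout.high v
  have b3 := hR.le_sp
  have b4 := hR.stack
  have b5 := hB.sb
  have b6 := hB.hundred
  have b7 := hB.mb
  unfold nodeClean
  refine triple_seq_load (u : ℕ) (by rw [h12, hent]) (abs_le.2 ⟨by omega, by omega⟩) ?_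
  refine triple_seq_arith (L + (u : ℕ)) (by simp [Op.eval, h3])
    (abs_le.2 ⟨by omega, by omega⟩) ?_
  refine triple_seq_bump (L + (u : ℕ)) (m (L + (u : ℕ))) (by simp) (by simp) rfl
    (abs_le.2 ⟨by omega, by omega⟩) (abs_le.2 ⟨by omega, by omega⟩)
    (abs_le.2 ⟨by omega, by omega⟩) ?_
  refine triple_seq_const (abs_le.2 ⟨by omega, by omega⟩) ?_
  refine triple_seq_arith (off v + (i + 1 : ℕ)) (by simp [Op.eval, h12]; ring)
    (abs_le.2 ⟨by omega, by omega⟩) ?_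
  refine triple_arith ((adj v).length - (i + 1 : ℕ)) (by simp [Op.eval, h13])
    (abs_le.2 ⟨by omega, by omega⟩) (by norm_num) ?_
  refine ⟨by simp [h10], by simp, by simp [h13], by simp [h14], by simp, ?_, ?_⟩
  · repeat refine keep_update ?_ (by norm_num) _
    exact hkeep
  · rw [← hset]
    exact hmem.erase huX

/-- The first loop computes the ratio while marking `v` and its neighbours; the second loop takes
the same marks back, so that the caller finds its own set unchanged. -/
theorem nodeExpand_spec (hdeg : ∀ v, 3 ≤ G.degree v) (hadj : IsAdjacencyLists G adj)
    (hB : Bounds W Q MB SB) (hP : P[1]? = some nodeProc)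
    (hR : Ready adj off L Q MB SB S (k + (adj v).length) sp r₀ m₀) (hk : 0 ≤ k) (hv : v ∈ S)
    (h10 : r 10 = (v : ℕ)) (h11 : r 11 = k) (h12 : r 12 = off v)
    (h13 : r 13 = off v + (adj v).length) (hkeep : ∀ x, 1 ≤ x → x < 10 → r x = r₀ x)
    {β : ℝ} (hβ : 0 ≤ β)
    (IH : ∀ (S' : Finset (Fin n)) (u : Fin n) (sp' : ℤ) (r : ℕ → ℤ) (m : ℤ → ℤ),
      Ready adj off L Q MB SB S' k sp' r m → u ∈ S' → r 10 = (u : ℕ) → r 11 = k →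
        Triple W P nodeProc r m β (NodePost G Q k sp' S' u r m)) :
    Triple W P nodeExpand r m₀ (100 + (adj v).length * (β + 210))
      (NodePost G Q (k + (adj v).length) sp S v r₀ m₀) := by
  have hlen := length_eq_degree G hadj v
  have hd := hdeg v
  have h2 : r 2 = Q := (hkeep 2 (by norm_num) (by norm_num)).trans hR.rQ
  have h3 : r 3 = L := (hkeep 3 (by norm_num) (by norm_num)).trans hR.rL
  obtain ⟨w1, w2, w3⟩ := hR.marks v
  have hvn := v.2
  have b1 := hR.layout.low v
  have b2 := hR.layout.high v
  have b3 := hR.le_sp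
  have b4 := hR.stack
  have b5 := hB.sb
  have b6 := hB.hundred
  have b7 := hB.mb
  have b8 := hB.pos
  have b9 := hB.sq
  have b12 : 2 * Q ≤ W := by nlinarith
  unfold nodeExpand
  -- initialisation
  refine triple_seq 20 ?_
  refine triple_seq_arith (L + (v : ℕ)) (by simp [Op.eval, h3, h10])
    (abs_le.2 ⟨by omega, by omega⟩) ?_
  refine triple_seq_bump (L + (v : ℕ)) (m₀ (L + (v : ℕ))) (by simp) (by simp) rfl
    (abs_le.2 ⟨by omega, by omega⟩) (abs_le.2 ⟨by omega, by omega⟩)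
    (abs_le.2 ⟨by omega, by omega⟩) ?_
  refine triple_seq_const (by simp) ?_
  refine triple_seq_arith Q (by simp [Op.eval, h2]) (abs_le.2 ⟨by omega, by omega⟩) ?_
  refine triple_arith (adj v).length (by simp [Op.eval, h12, h13])
    (abs_le.2 ⟨by omega, by omega⟩) (by norm_num) ?_
  -- the loop over the neighbours
  refine triple_seq (1 + (adj v).length * (β + 150 + 1)) ((triple_while
    (fun i r m => LoopInv G adj off L Q k sp S v r₀ m₀ i r m ∧ r 15 = (adj v).length - i)
    ?_ ?_ ?_).mono le_rfl ?_)
  · rintro i hi r' m' ⟨hI, h15⟩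
    exact ⟨by omega, nodeBody_spec G hdeg hadj hB hP hR hk hI hi hβ IH⟩
  · rintro r' m' ⟨-, h15⟩
    omega
  · refine ⟨⟨by simp [h10], by simp [h11], by simp [h12], by simp [h13], ?_, by simp, ?_, ?_⟩,
      by simp⟩
    · repeat refine keep_update ?_ (by norm_num) _
      exact hkeep
    · exact Marked.empty.insert (by simp)
    · simpa [Finset.sdiff_singleton_eq_erase] using
        approxFold_init G hdeg Q hB.pos.le (errBound Q k) (S.erase v)
  rintro r₁ m₁ ⟨hI, -⟩
  have hnb : (adj v).toFinset = G.neighborFinset v := by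
    ext w
    simp [(hadj v).2]
  -- After the whole list, the removed set is the closed neighbourhood of `v`, and the accumulator
  -- approximates Q times the ratio.
  have hT : ApproxRatio G Q (k + (adj v).length) S v (r₁ 14) := by
    refine approxRatio_of_approxFold G hdeg hB.pos hv (by omega) ?_
    have h := hI.fold
    rw [List.take_length, hnb] at h
    rwa [← hlen, add_sub_cancel_right]
  have hT0 := hT.1
  have hTQ := hI.le_Q
  have hmem₁ := hI.mem
  have hlay := hR.layout.congr (m := m₁) fun x hx => hmem₁.low (by omega) hx
  -- removal of the marks
  refine triple_seq 7 ?_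
  refine triple_seq_const (abs_le.2 ⟨by omega, by omega⟩) ?_
  refine triple_seq_arith ((v : ℕ) + 3) (by simp [Op.eval, hI.r10])
    (abs_le.2 ⟨by omega, by omega⟩) ?_
  refine triple_seq_load (off v) (by simp [hlay.start]) (abs_le.2 ⟨by omega, by omega⟩) ?_
  refine triple_arith (adj v).length (by simp [Op.eval, hI.r13])
    (abs_le.2 ⟨by omega, by omega⟩) (by norm_num) ?_
  refine triple_seq (1 + (adj v).length * (50 + 1)) ((triple_while
    (CleanInv adj off L sp (r₁ 14) v r₀ m₀) ?_ ?_ ?_).mono le_rfl ?_)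
  · intro i hi r' m' hC
    have := hC.r15
    exact ⟨by omega, nodeClean_spec G hadj hB hR (by omega) hC hi⟩
  · intro r' m' hC
    have := hC.r15
    omega
  · refine ⟨by simp [hI.r10], by simp, by simp [hI.r13], by simp, by simp, ?_, ?_⟩
    · repeat refine keep_update ?_ (by norm_num) _
      exact hI.keep
    · rw [List.drop_zero]
      rwa [List.take_length] at hmem₁
  -- the result
  rintro r₂ m₂ ⟨g10, g12, g13, g14, g15, gkeep, gmem⟩
  have g3 : r₂ 3 = L := (gkeep 3 (by norm_num) (by norm_num)).trans hR.rL
  rw [List.drop_length] at gmem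
  have hmv := gmem.mark hR.le_sp v
  rw [if_pos (by simp)] at hmv
  refine triple_seq_arith (L + (v : ℕ)) (by simp [Op.eval, g3, g10])
    (abs_le.2 ⟨by omega, by omega⟩) ?_
  refine triple_seq_bump (L + (v : ℕ)) (m₂ (L + (v : ℕ))) (by simp) (by simp) rfl
    (abs_le.2 ⟨by omega, by omega⟩) (abs_le.2 ⟨by omega, by omega⟩)
    (abs_le.2 ⟨by omega, by omega⟩) ?_
  refine triple_seq_const (by simp) ?_
  refine triple_arith (r₁ 14) (by simp [Op.eval, g14])
    (abs_le.2 ⟨by omega, by omega⟩) (by nlinarith) ?_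
  refine ⟨by simpa using hT, ?_, fun x hx => ?_⟩
  · refine keep_update_zero ?_ _
    repeat refine keep_update ?_ (by norm_num) _
    exact gkeep
  · have := gmem.erase (u := v) (by simp)
    rw [List.toFinset_nil, insert_empty_eq, Finset.erase_singleton] at this
    exact this.eq hx

/-- A bound for the number of steps of the evaluation of a vertex with budget `k`. -/
noncomputable def nodeTime (k : ℕ) : ℝ := 1000 * (3 / 2 : ℝ) ^ k - 800

theorem nodeTime_nonneg (k : ℕ) : 200 ≤ nodeTime k := by
  have : (1 : ℝ) ≤ (3 / 2 : ℝ) ^ k := one_le_pow₀ (by norm_num)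
  unfold nodeTime
  linarith

/-- The summand -800 in `nodeTime` absorbs the overhead: since d ≥ 3, it is saved d times on the
left and spent once on the right. -/
theorem nodeTime_rec (k d : ℕ) (hd : 3 ≤ d) :
    150 + d * (nodeTime k + 210) ≤ nodeTime (k + d) := by
  have h1 := natCast_le_three_halves_pow d
  have h2 : (0 : ℝ) < (3 / 2 : ℝ) ^ k := by positivity
  have h3 : (3 : ℝ) ≤ d := by exact_mod_cast hd
  unfold nodeTime
  rw [pow_add]
  nlinarith [mul_le_mul_of_nonneg_left h1 h2.le]

/-- Strong induction on the budget, with the set, the vertex and the stack pointer arbitrary,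
because all of them change in the recursive calls. -/
theorem nodeProc_spec (hdeg : ∀ v, 3 ≤ G.degree v) (hadj : IsAdjacencyLists G adj)
    (hB : Bounds W Q MB SB) (hP : P[1]? = some nodeProc) (k : ℕ) :
    ∀ (S : Finset (Fin n)) (v : Fin n) (sp : ℤ) (r : ℕ → ℤ) (m : ℤ → ℤ),
      Ready adj off L Q MB SB S k sp r m → v ∈ S → r 10 = (v : ℕ) → r 11 = k →
        Triple W P nodeProc r m (nodeTime k) (NodePost G Q k sp S v r m) := by
  induction k using Nat.strong_induction_on with
  | _ k IH =>
  intro S v sp r m hR hv h10 h11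
  have hlen := length_eq_degree G hadj v
  have hd := hdeg v
  have hvn := v.2
  have b1 := hR.layout.low v
  have b2 := hR.layout.high v
  have b3 := hR.le_sp
  have b4 := hR.stack
  have b5 := hB.sb
  have b6 := hB.hundred
  have hlay := hR.layout
  have ht := nodeTime_nonneg k
  unfold nodeProc
  refine triple_seq_const (abs_le.2 ⟨by omega, by omega⟩) ?_
  refine triple_seq_arith ((v : ℕ) + 3) (by simp [Op.eval, h10])
    (abs_le.2 ⟨by omega, by omega⟩) ?_
  refine triple_seq_load (off v) (by simp [hlay.start]) (abs_le.2 ⟨by omega, by omega⟩) ?_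
  refine triple_seq_const (abs_le.2 ⟨by omega, by omega⟩) ?_
  refine triple_seq_arith ((v : ℕ) + 4) (by simp [Op.eval]; ring)
    (abs_le.2 ⟨by omega, by omega⟩) ?_
  refine triple_seq_load (off v + (adj v).length) (by simp [hlay.finish])
    (abs_le.2 ⟨by omega, by omega⟩) ?_
  refine triple_seq_arith (adj v).length (by simp [Op.eval]) (abs_le.2 ⟨by omega, by omega⟩) ?_
  refine triple_seq_arith (k - (adj v).length) (by simp [Op.eval, h11])
    (abs_le.2 ⟨by omega, by omega⟩) ?_
  refine triple_seq_const (abs_le.2 ⟨by omega, by omega⟩) ?_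
  -- The 1 makes the positivity test mean that the degree is at most k.
  refine triple_seq_arith (k - (adj v).length + 1) (by simp [Op.eval])
    (abs_le.2 ⟨by omega, by omega⟩) ?_
  refine triple_ifPos (fun h => ?_) (fun h => ?_)
  · have hdk : (adj v).length ≤ k := by
      simp at h
      omega
    obtain ⟨j, rfl⟩ := Nat.exists_eq_add_of_le' hdk
    have hj : ((j + (adj v).length : ℕ) : ℤ) = (j : ℤ) + (adj v).length := by push_cast; rfl
    rw [hj] at hR
    refine (nodeExpand_spec G (k := j) (r₀ := r) hdeg hadj hB hP hR (by omega) hv (by simp [h10])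
      (by simp) (by simp) (by simp) ?_ (by linarith [nodeTime_nonneg j])
      (IH j (by omega))).mono ?_ ?_
    · repeat refine keep_update ?_ (by norm_num) _
      exact fun _ _ _ => rfl
    · linarith [nodeTime_rec j (adj v).length (by omega)]
    · rw [hj]
      exact fun _ _ h => h
  · have hdk : (k : ℤ) < G.degree v := by
      simp at h
      omega
    refine triple_const (by simp) (by linarith) ⟨?_, ?_, fun _ _ => rfl⟩
    · simpa using approxRatio_zero G hdeg hB.pos.le hv hdk
    · refine keep_update_zero ?_ _
      repeat refine keep_update ?_ (by norm_num) _
      exact fun _ _ _ => rfl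

end Node

end WordRAM

/-! ### The input -/

section Input

variable {n : ℕ} (adj : Fin n → List (Fin n))

/-- The address at which the adjacency list of vertex `i` starts. -/
def listAddress (i : ℕ) : ℕ :=
  n + 4 + ∑ u : Fin n, if u.val < i then (adj u).length else 0

theorem listAddress_succ (v : Fin n) :
    listAddress adj (v + 1) = listAddress adj v + (adj v).length := by
  have h : ∀ u : Fin n, (if u.val < v + 1 then (adj u).length else 0) =
      (if u.val < v then (adj u).length else 0) + if u = v then (adj v).length else 0 := by
    intro u
    by_cases huv : u = v
    · subst huv
      simp
    · have : u.val ≠ v.val := fun h => huv (Fin.ext h)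
      simp only [huv, if_false, add_zero]
      congr 1
      exact propext (by omega)
  rw [listAddress, listAddress, Finset.sum_congr rfl fun u _ => h u, Finset.sum_add_distrib]
  simp [add_assoc]

theorem listAddress_mono {i j : ℕ} (hij : i ≤ j) : listAddress adj i ≤ listAddress adj j := by
  unfold listAddress
  gcongr with u
  split_ifs <;> omega

theorem listAddress_self : listAddress adj n = n + 4 + ∑ u, (adj u).length := by
  simp [listAddress]

theorem le_listAddress (i : ℕ) : n + 4 ≤ listAddress adj i := Nat.le_add_right _ _

theorem graphInput_head (p q : ℕ) : (graphInput adj p q).getD 0 0 = n ∧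
    (graphInput adj p q).getD 1 0 = p ∧ (graphInput adj p q).getD 2 0 = q := by
  simp [graphInput]

theorem graphInput_address (p q : ℕ) {i : ℕ} (hi : i ≤ n) :
    (graphInput adj p q).getD (i + 3) 0 = listAddress adj i := by
  have : i < ((List.range (n + 1)).map
      (fun i => ((n + 4 + ∑ u : Fin n, if u.val < i then (adj u).length else 0 : ℕ) : ℤ))).length := by
    simp; omega
  rw [List.getD_eq_getElem?_getD, graphInput, List.append_assoc,
    List.getElem?_append_right (by simp), List.getElem?_append_left (by simpa using this)]
  simp [listAddress, Nat.lt_succ_of_le hi]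

theorem getElem?_flatMap_append {α β : Type*} (f : α → List β) (l₁ l₂ : List α) (a : α) {i : ℕ}
    (hi : i < (f a).length) :
    ((l₁ ++ a :: l₂).flatMap f)[(l₁.flatMap f).length + i]? = some (f a)[i] := by
  rw [List.flatMap_append, List.getElem?_append_right (by omega), List.flatMap_cons,
    Nat.add_sub_cancel_left, List.getElem?_append_left hi, List.getElem?_eq_getElem hi]

theorem sum_take_finRange (f : Fin n → ℕ) (k : ℕ) :
    (((List.finRange n).take k).map f).sum = ∑ u : Fin n, if u.val < k then f u else 0 := by
  rw [Fin.sum_univ_def]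
  conv_rhs => rw [← List.take_append_drop k (List.finRange n), List.map_append, List.sum_append]
  have h1 : ((List.finRange n).take k).map (fun u : Fin n => if u.val < k then f u else 0) =
      ((List.finRange n).take k).map f := by
    refine List.map_congr_left fun u hu => if_pos ?_
    obtain ⟨j, hj, rfl⟩ := List.getElem_of_mem hu
    simp at hj ⊢
    omega
  have h2 : (((List.finRange n).drop k).map
      (fun u : Fin n => if u.val < k then f u else 0)).sum = 0 := by
    refine List.sum_eq_zero fun x hx => ?_
    obtain ⟨u, hu, rfl⟩ := List.mem_map.1 hx
    obtain ⟨j, hj, rfl⟩ := List.getElem_of_mem hu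
    simp
  rw [h1, h2, add_zero]

theorem graphInput_entry (p q : ℕ) (v : Fin n) {i : ℕ} (hi : i < (adj v).length) :
    (graphInput adj p q).getD (listAddress adj v + i) 0 = (((adj v)[i] : Fin n) : ℕ) := by
  set f : Fin n → List ℤ := fun v => (adj v).map fun w => (w.val : ℤ) with hf
  have hsplit : List.finRange n =
      (List.finRange n).take v ++ v :: (List.finRange n).drop (v + 1) := by
    conv_lhs => rw [← List.take_append_drop v (List.finRange n)]
    rw [List.drop_eq_getElem_cons (by simp)]
    simp
  have hlen : (((List.finRange n).take v).flatMap f).length =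
      ∑ u : Fin n, if u.val < v then (adj u).length else 0 := by
    rw [List.length_flatMap, ← sum_take_finRange]
    simp [hf]
  have hi' : i < (f v).length := by simpa [hf] using hi
  have key := getElem?_flatMap_append f ((List.finRange n).take v) ((List.finRange n).drop (v + 1)) v hi'
  rw [← hsplit, hlen] at key
  rw [List.getD_eq_getElem?_getD, graphInput, List.getElem?_append_right]
  · have : listAddress adj v + i - ([(n : ℤ), (p : ℤ), (q : ℤ)] ++ (List.range (n + 1)).map
        (fun i => ((n + 4 + ∑ u : Fin n, if u.val < i then (adj u).length else 0 : ℕ) : ℤ))).length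
        = (∑ u : Fin n, if u.val < v then (adj u).length else 0) + i := by
      simp [listAddress]
      omega
    rw [this, key]
    simp [hf]
  · have := le_listAddress adj v
    simp
    omega

namespace WordRAM

theorem layout_graphInput (p q : ℕ) :
    Layout adj (fun v => listAddress adj v) (listAddress adj n)
      (initial (graphInput adj p q)).mem where
  start v := by
    have h : (0 : ℤ) ≤ (v : ℕ) + 3 := by positivity
    have h' : (((v : ℕ) : ℤ) + 3).toNat = v + 3 := by omega
    simp only [initial, if_pos h, h']
    exact graphInput_address adj p q v.2.le
  finish v := by
    have h : (0 : ℤ) ≤ (v : ℕ) + 4 := by positivity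
    have h' : (((v : ℕ) : ℤ) + 4).toNat = (v + 1) + 3 := by omega
    simp only [initial, if_pos h, h']
    rw [graphInput_address adj p q v.2, listAddress_succ]
    push_cast
    rfl
  entry v i hi := by
    have h : (0 : ℤ) ≤ (listAddress adj v : ℤ) + i := by positivity
    have h' : ((listAddress adj v : ℤ) + i).toNat = listAddress adj v + i := by omega
    simp only [initial, if_pos h, h']
    exact graphInput_entry adj p q v hi
  low v := by exact_mod_cast le_listAddress adj v
  high v := by
    have := listAddress_mono adj (show (v : ℕ) + 1 ≤ n from v.2)
    rw [listAddress_succ] at this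
    exact_mod_cast this

theorem length_graphInput (p q : ℕ) : (graphInput adj p q).length = listAddress adj n := by
  rw [listAddress_self]
  simp [graphInput, List.length_flatMap, Fin.sum_univ_def]
  omega

theorem initial_mem_of_le (p q : ℕ) {x : ℤ} (hx : (listAddress adj n : ℤ) ≤ x) :
    (initial (graphInput adj p q)).mem x = 0 := by
  have h : 0 ≤ x := by omega
  simp only [initial, if_pos h]
  rw [List.getD_eq_default _ _ (by rw [length_graphInput]; omega)]

end WordRAM

end Input

/-! ### The telescoping product in floating form. -/

section Mantissa

variable {n : ℕ} (G : SimpleGraph (Fin n)) [DecidableRel G.Adj]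

/-- Multiplication of the mantissa `R` by the approximation `1 - A / Q` of `1 - a`. -/
theorem mantissa_step {Q A R : ℤ} {a : ℝ} (hQ : 0 < Q) (hA : 0 ≤ A) (hAa : (A : ℝ) ≤ Q * a)
    (ha : a ≤ 8 / 27) (herr : Q * a - A ≤ 18) (hR : Q ≤ R) (hR2 : R ≤ 2 * Q) :
    Q ≤ 2 * (R * (Q - A) / Q) ∧ R * (Q - A) / Q ≤ 2 * Q ∧
      ((R * (Q - A) / Q : ℤ) : ℝ) ≤ Real.exp (26 / Q) * (R * (1 - a)) ∧
      Real.exp (-(2 / Q)) * (R * (1 - a)) ≤ (R * (Q - A) / Q : ℤ) := by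
  have hQ' : (0 : ℝ) < Q := by exact_mod_cast hQ
  have hR' : (Q : ℝ) ≤ R := by exact_mod_cast hR
  have hA27 : 27 * A ≤ 8 * Q := by
    have : (27 : ℝ) * A ≤ 8 * Q := by nlinarith
    exact_mod_cast this
  set Z := R * (Q - A) / Q
  have hZ0 : Q - A ≤ Z := by
    refine (Int.le_ediv_iff_mul_le hQ).2 ?_
    nlinarith
  have hZ1 : (Z : ℝ) * Q ≤ R * (Q - A) := by
    have := Int.ediv_mul_le (R * (Q - A)) hQ.ne'
    exact_mod_cast this
  have hZ2 : (R : ℝ) * (Q - A) < (Z + 1) * Q := by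
    have := Int.lt_ediv_add_one_mul_self (R * (Q - A)) hQ
    exact_mod_cast this
  have hZ3 : Z ≤ R := by
    refine Int.ediv_le_of_le_mul hQ ?_
    nlinarith
  -- The factor is at least 19/27 > 1/2, so a single doubling brings the mantissa back into its
  -- range.
  have hZQ : (Q : ℝ) ≤ 2 * Z := by exact_mod_cast (show Q ≤ 2 * Z by omega)
  refine ⟨by omega, by omega, ?_, ?_⟩
  · have e1 : 1 + 26 / (Q : ℝ) ≤ Real.exp (26 / Q) := by
      have := Real.add_one_le_exp (26 / (Q : ℝ))
      linarith
    have e2 : (Z : ℝ) ≤ (1 + 26 / Q) * (R * (1 - a)) := by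
      have h3 : (1 + 26 / (Q : ℝ)) * (R * (1 - a)) = (Q + 26) * (R * (1 - a)) / Q := by
        field_simp
      rw [h3, le_div_iff₀ hQ']
      have h4 : (R : ℝ) * (Q - A) ≤ R * (Q * (1 - a) + 18) :=
        mul_le_mul_of_nonneg_left (by linarith) (by linarith)
      -- The absolute error 18 is covered because 26 (1 - a) ≥ 26 * 19/27 > 18.
      nlinarith
    have h5 : 0 ≤ (R : ℝ) * (1 - a) := mul_nonneg (by linarith) (by linarith)
    exact e2.trans (mul_le_mul_of_nonneg_right e1 h5)
  · have e1 : 1 + 2 / (Q : ℝ) ≤ Real.exp (2 / Q) := by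
      have := Real.add_one_le_exp (2 / (Q : ℝ))
      linarith
    have e2 : (R : ℝ) * (1 - a) ≤ Z + 1 := by
      have h4 : (R : ℝ) * (1 - a) * Q ≤ R * (Q - A) := by nlinarith
      exact le_of_mul_le_mul_right (h4.trans hZ2.le) hQ'
    -- The floor loses at most 1, which is a relative loss of at most 2/Q, since Z ≥ Q/2.
    have e3 : (Z : ℝ) + 1 ≤ Z * (1 + 2 / Q) := by
      have : 1 ≤ (Z : ℝ) * (2 / Q) := by
        rw [mul_div_assoc', le_div_iff₀ hQ']
        linarith
      linarith
    have hZpos : (0 : ℝ) ≤ Z := by linarith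
    rw [Real.exp_neg, inv_mul_le_iff₀ (Real.exp_pos _), mul_comm (Real.exp _)]
    exact (e2.trans e3).trans (mul_le_mul_of_nonneg_left e1 hZpos)

/-- `R * 2 ^ b` is the approximation of the number of orientations without sinks, after the
vertices less than `i` have been treated. -/
def PartialEstimate (Q : ℤ) (i : ℕ) (R b : ℤ) : Prop :=
  Real.exp (-(2 * i / Q)) * (2 ^ G.edgeFinset.card * sfo G) ≤
      R * 2 ^ b * noSinkCount G (Finset.univ.filter fun u : Fin n => i ≤ u.val) ∧
    R * 2 ^ b * noSinkCount G (Finset.univ.filter fun u : Fin n => i ≤ u.val) ≤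
      Real.exp (26 * i / Q) * (2 ^ G.edgeFinset.card * sfo G)

theorem partialEstimate_zero (l : ℕ) :
    PartialEstimate G (2 ^ l) 0 (2 ^ l) (G.edgeFinset.card - l) := by
  have h : ((2 ^ l : ℤ) : ℝ) * (2 : ℝ) ^ ((G.edgeFinset.card : ℤ) - l) =
      2 ^ G.edgeFinset.card := by
    rw [zpow_sub₀ (by norm_num)]
    push_cast
    simp only [zpow_natCast]
    field_simp
  simp only [PartialEstimate, h]
  simp [noSinkCount_univ]

theorem PartialEstimate.double {Q : ℤ} {i : ℕ} {R b : ℤ} (h : PartialEstimate G Q i R b) :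
    PartialEstimate G Q i (R + R) (b - 1) := by
  have e : ((R + R : ℤ) : ℝ) * (2 : ℝ) ^ (b - 1) = R * 2 ^ b := by
    rw [zpow_sub_one₀ (by norm_num)]
    push_cast
    ring
  rwa [PartialEstimate, e]

/-- Removing `v` multiplies the count by 1 / (1 - a) and the mantissa by about 1 - a. The product
changes only by the relative errors, whose exponents add up. -/
theorem PartialEstimate.succ (hdeg : ∀ v, 3 ≤ G.degree v) {Q : ℤ} {R R' b : ℤ} {v : Fin n}
    (h : PartialEstimate G Q v R b)
    (hup : (R' : ℝ) ≤ Real.exp (26 / Q) *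
      (R * (1 - sinkRatio G (Finset.univ.filter fun u : Fin n => v.val ≤ u.val) v)))
    (hlo : Real.exp (-(2 / Q)) *
      (R * (1 - sinkRatio G (Finset.univ.filter fun u : Fin n => v.val ≤ u.val) v)) ≤ R') :
    PartialEstimate G Q (v + 1) R' b := by
  have hset : (Finset.univ.filter fun u : Fin n => v.val ≤ u.val).erase v =
      Finset.univ.filter fun u : Fin n => v.val + 1 ≤ u.val := by
    ext u
    simp only [Finset.mem_erase, Finset.mem_filter, Finset.mem_univ, true_and, ne_eq, Fin.ext_iff]
    omega
  have hmul := noSinkCount_erase_mul G hdeg (Finset.univ.filter fun u : Fin n => v.val ≤ u.val) v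
  rw [hset] at hmul
  set a := sinkRatio G (Finset.univ.filter fun u : Fin n => v.val ≤ u.val) v
  set N := (noSinkCount G (Finset.univ.filter fun u : Fin n => v.val + 1 ≤ u.val) : ℝ)
  obtain ⟨h1, h2⟩ := h
  rw [← hmul] at h1 h2
  have hN : 0 ≤ (2 : ℝ) ^ b * N := by positivity
  have e1 : Real.exp (-(2 * ((v + 1 : ℕ) : ℝ) / Q)) =
      Real.exp (-(2 / Q)) * Real.exp (-(2 * (v : ℕ) / Q)) := by
    rw [← Real.exp_add]; congr 1; push_cast; ring
  have e2 : Real.exp (26 * ((v + 1 : ℕ) : ℝ) / Q) =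
      Real.exp (26 / Q) * Real.exp (26 * (v : ℕ) / Q) := by
    rw [← Real.exp_add]; congr 1; push_cast; ring
  refine ⟨?_, ?_⟩
  · rw [e1, mul_assoc]
    refine (mul_le_mul_of_nonneg_left h1 (Real.exp_pos _).le).trans ?_
    calc Real.exp (-(2 / Q)) * (R * 2 ^ b * (N * (1 - a))) =
          Real.exp (-(2 / Q)) * (R * (1 - a)) * (2 ^ b * N) := by ring
      _ ≤ R' * (2 ^ b * N) := mul_le_mul_of_nonneg_right hlo hN
      _ = R' * 2 ^ b * N := by ring
  · rw [e2, mul_assoc (Real.exp (26 / Q))]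
    refine le_trans ?_ (mul_le_mul_of_nonneg_left h2 (Real.exp_pos _).le)
    calc (R' : ℝ) * 2 ^ b * N = R' * (2 ^ b * N) := by ring
      _ ≤ Real.exp (26 / Q) * (R * (1 - a)) * (2 ^ b * N) := mul_le_mul_of_nonneg_right hup hN
      _ = Real.exp (26 / Q) * (R * 2 ^ b * (N * (1 - a))) := by ring

/-- When no vertex is left, the count is 2^m and cancels. The exponents 2n/Q and 26n/Q are both at
most 32n/Q ≤ ε. -/
theorem PartialEstimate.final {Q : ℤ} {R b : ℤ} {ε : ℝ} (h : PartialEstimate G Q n R b)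
    (hQ : 0 < Q) (hε : 32 * n ≤ ε * Q) :
    Real.exp (-ε) * sfo G ≤ (R : ℝ) * 2 ^ b ∧ (R : ℝ) * 2 ^ b ≤ Real.exp ε * sfo G := by
  have hQ' : (0 : ℝ) < Q := by exact_mod_cast hQ
  have hset : (Finset.univ.filter fun u : Fin n => n ≤ u.val) = ∅ := by
    ext u
    simp
  obtain ⟨h1, h2⟩ := h
  rw [hset, noSinkCount_empty] at h1 h2
  push_cast at h1 h2
  have hp : (0 : ℝ) < 2 ^ G.edgeFinset.card := by positivity
  have hn : (0 : ℝ) ≤ n := by positivity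
  have hs : (0 : ℝ) ≤ sfo G := by positivity
  rw [mul_left_comm, mul_comm _ ((2 : ℝ) ^ G.edgeFinset.card)] at h1 h2
  have h1' := le_of_mul_le_mul_left h1 hp
  have h2' := le_of_mul_le_mul_left h2 hp
  constructor
  · refine le_trans (mul_le_mul_of_nonneg_right (Real.exp_le_exp.2 ?_) hs) h1'
    rw [neg_le_neg_iff, div_le_iff₀ hQ']
    linarith
  · refine h2'.trans (mul_le_mul_of_nonneg_right (Real.exp_le_exp.2 ?_) hs)
    rw [div_le_iff₀ hQ']
    linarith

/-- Budget 7l suffices for Q = 2^l because 2 * (9/10)^7 < 1. -/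
theorem errBound_two_pow_le (l : ℕ) : 2 * errBound (2 ^ l) (7 * l : ℕ) ≤ 18 := by
  have h : ((2 ^ l : ℤ) : ℝ) * (9 / 10 : ℝ) ^ (((7 * l : ℕ) : ℤ)).toNat ≤ 1 := by
    rw [Int.toNat_natCast, pow_mul]
    push_cast
    rw [← mul_pow]
    exact pow_le_one₀ (by norm_num) (by norm_num)
  unfold errBound
  linarith

end Mantissa

/-! ### The main procedure -/

namespace WordRAM

/-- Doubling of the scaling factor, as long as it is too small. -/
def scaleBody : Cmd :=
  .arith .add 2 2 2 ;; .const 10 7 ;; .arith .add 5 5 10 ;; .const 10 1 ;; .arith .sub 1 1 10 ;;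
  .arith .mul 22 2 20 ;; .arith .sub 22 21 22

/-- Treatment of one vertex. -/
def vertexBody : Cmd :=
  (.arith .sub 10 6 7 ;; .const 11 0 ;; .arith .add 11 11 5 ;; .call 1) ;;
  .arith .sub 20 6 7 ;; .arith .add 20 3 20 ;; bump 20 1 ;;
  .arith .sub 21 2 0 ;; .arith .mul 8 8 21 ;; .arith .div 8 8 2 ;;
  .const 22 1 ;; .arith .sub 7 7 22 ;; .arith .sub 22 2 8 ;;
  .ifPos 22 (.arith .add 8 8 8 ;; .const 22 1 ;; .arith .sub 1 1 22) .skip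

/-- The main procedure. -/
def mainProc : Cmd :=
  (.const 10 0 ;; .load 6 10 ;; .const 10 1 ;; .load 20 10 ;; .const 10 2 ;; .load 21 10 ;;
    .const 10 3 ;; .arith .add 10 6 10 ;; .load 3 10 ;; .arith .sub 1 3 6 ;; .const 10 4 ;;
    .arith .sub 1 1 10 ;; .const 10 2 ;; .arith .div 1 1 10 ;; .arith .add 4 3 6 ;;
    .const 10 32 ;; .arith .mul 21 21 6 ;; .arith .mul 21 21 10 ;; .const 2 1 ;; .const 5 0 ;;
    .arith .mul 22 2 20 ;; .arith .sub 22 21 22) ;;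
  .whilePos 22 scaleBody ;;
  (.const 10 0 ;; .arith .add 7 6 10 ;; .arith .add 8 2 10) ;;
  .whilePos 7 vertexBody ;;
  .const 10 0 ;; .arith .add 0 8 10

/-- The program. -/
def sinkFreeProgram : Program := [mainProc, nodeProc]

section Main

variable {n : ℕ} (G : SimpleGraph (Fin n)) [DecidableRel G.Adj] {adj : Fin n → List (Fin n)}
  {off : Fin n → ℤ} {L p D e : ℤ} {W l : ℕ} {P : Program} {r : ℕ → ℤ} {m : ℤ → ℤ}

/-- The state after the scaling factor has been doubled `i` times. -/
structure ScaleInv (L n p D e : ℤ) (m₀ : ℤ → ℤ) (i : ℕ) (r : ℕ → ℤ) (m : ℤ → ℤ) : Prop where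
  mem : m = m₀
  r1 : r 1 = e - i
  r2 : r 2 = 2 ^ i
  r3 : r 3 = L
  r4 : r 4 = L + n
  r5 : r 5 = 7 * i
  r6 : r 6 = n
  r20 : r 20 = p
  r21 : r 21 = D
  r22 : r 22 = D - 2 ^ i * p

theorem scaleBody_spec {m₀ : ℤ → ℤ} {i : ℕ} {n : ℤ}
    (h : ScaleInv L n p D e m₀ i r m) (hp : 0 < p) (he : 0 ≤ e)
    (hi : 0 < D - 2 ^ i * p) (hi7 : 7 * i + 7 ≤ W) (heW : e + i + 1 ≤ W) (hDW : 2 * D ≤ W) :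
    Triple W P scaleBody r m 30 (ScaleInv L n p D e m₀ (i + 1)) := by
  obtain ⟨hm, r1, r2, r3, r4, r5, r6, r20, r21, r22⟩ := h
  have hpow : (0 : ℤ) < 2 ^ i := by positivity
  have hpow' : (2 : ℤ) ^ i ≤ 2 ^ i * p := le_mul_of_one_le_right hpow.le hp
  have hsucc : (2 : ℤ) ^ (i + 1) = 2 ^ i + 2 ^ i := by ring
  unfold scaleBody
  refine triple_seq_arith (2 ^ (i + 1)) (by simp [Op.eval, r2, hsucc])
    (abs_le.2 ⟨by omega, by omega⟩) ?_
  refine triple_seq_const (abs_le.2 ⟨by omega, by omega⟩) ?_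
  refine triple_seq_arith (7 * (i + 1 : ℕ)) (by simp [Op.eval, r5]; ring)
    (abs_le.2 ⟨by omega, by omega⟩) ?_
  refine triple_seq_const (abs_le.2 ⟨by omega, by omega⟩) ?_
  refine triple_seq_arith (e - (i + 1 : ℕ)) (by simp [Op.eval, r1]; ring)
    (abs_le.2 ⟨by omega, by omega⟩) ?_
  have hmul : (2 : ℤ) ^ (i + 1) * p = 2 * (2 ^ i * p) := by ring
  refine triple_seq_arith (2 ^ (i + 1) * p) (by simp [Op.eval, r20])
    (abs_le.2 ⟨by omega, by omega⟩) ?_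
  refine triple_arith (D - 2 ^ (i + 1) * p) (by simp [Op.eval, r21])
    (abs_le.2 ⟨by omega, by omega⟩) (by norm_num) ?_
  exact ⟨hm, by simp, by simp, by simp [r3], by simp [r4], by simp, by simp [r6], by simp [r20],
    by simp [r21], by simp⟩

/-- The state after `i` vertices have been treated, with scaling factor `2 ^ l`. -/
structure VertexInv (adj : Fin n → List (Fin n)) (off : Fin n → ℤ) (L : ℤ) (l : ℕ)
    (i : ℕ) (r : ℕ → ℤ) (m : ℤ → ℤ) : Prop where
  r1 : |r 1| ≤ G.edgeFinset.card + l + i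
  r2 : r 2 = 2 ^ l
  r3 : r 3 = L
  r4 : r 4 = L + n
  r5 : r 5 = 7 * l
  r6 : r 6 = n
  r7 : r 7 = n - i
  r8 : 2 ^ l ≤ r 8 ∧ r 8 ≤ 2 * 2 ^ l
  layout : Layout adj off L m
  marks : ∀ u : Fin n, m (L + (u : ℕ)) = if u.val < i then 1 else 0
  est : PartialEstimate G (2 ^ l) i (r 8) (r 1)

theorem vertexBody_spec (hdeg : ∀ v, 3 ≤ G.degree v) (hadj : IsAdjacencyLists G adj)
    (hP : P[1]? = some nodeProc) {i : ℕ} (hI : VertexInv G adj off L l i r m) (hi : i < n)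
    (hL : 0 ≤ L) (hW1 : 2 * 2 ^ l * 2 ^ l ≤ W) (hW2 : L + n + 28 * l ≤ W)
    (hW3 : G.edgeFinset.card + l + n ≤ W) (hW4 : 100 ≤ W) :
    Triple W P vertexBody r m (nodeTime (7 * l) + 60) (VertexInv G adj off L l (i + 1)) := by
  obtain ⟨h1, h2, h3, h4, h5, h6, h7, ⟨h8, h8'⟩, hlay, hmarks, hest⟩ := hI
  set v : Fin n := ⟨i, hi⟩ with hvdef
  set S := Finset.univ.filter fun u : Fin n => i ≤ u.val with hS
  have hvS : v ∈ S := by simp [S, v]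
  have hQ0 : (0 : ℤ) < 2 ^ l := by positivity
  have hW1' : (2 : ℤ) * 2 ^ l * 2 ^ l ≤ W := by exact_mod_cast hW1
  -- For l ≥ 1 the bound follows from that on 2Q²; for l = 0 it needs W ≥ 100.
  have hQW : (4 : ℤ) * 2 ^ l ≤ W ∨ l = 0 := by
    rcases Nat.eq_zero_or_pos l with h | h
    · exact Or.inr h
    · left
      have : (2 : ℤ) ^ 1 ≤ 2 ^ l := pow_le_pow_right₀ (by norm_num) h
      nlinarith
  have hQW : (4 : ℤ) * 2 ^ l ≤ W := by
    rcases hQW with h | h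
    · exact h
    · subst h
      norm_num
      omega
  -- At the top level the counters are 0 or 1 and the stack starts behind the n counters.
  have hB : Bounds W (2 ^ l) ((7 * l : ℕ) + 1) (L + n + 4 * (7 * l : ℕ)) :=
    ⟨hQ0, hW1', by omega, by omega, hW4⟩
  have hb := abs_le.1 h1
  unfold vertexBody
  refine triple_seq (nodeTime (7 * l) + 7) ?_
  refine triple_seq_arith i (by simp [Op.eval, h6, h7]) (abs_le.2 ⟨by omega, by omega⟩) ?_
  refine triple_seq_const (by simp) ?_
  refine triple_seq_arith (7 * l : ℕ) (by simp [Op.eval, h5]) (abs_le.2 ⟨by omega, by omega⟩) ?_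
  have hready : Ready adj off L (2 ^ l) ((7 * l : ℕ) + 1) (L + n + 4 * (7 * l : ℕ)) S
      (7 * l : ℕ) (L + n) (Function.update (Function.update (Function.update r 10 (i : ℤ))
        11 0) 11 ((7 * l : ℕ) : ℤ)) m := by
    refine ⟨hlay, fun u => ?_, by simp [h2], by simp [h3], by simp [h4], le_rfl, by omega, le_rfl⟩
    rw [hmarks u, hS]
    simp only [Finset.mem_filter, Finset.mem_univ, true_and]
    split_ifs
    · exact ⟨by omega, ⟨fun h => by omega, fun h => by omega⟩, by omega⟩
    · exact ⟨by omega, ⟨fun h => by omega, fun h => by omega⟩, by omega⟩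
  refine triple_call hP ((nodeProc_spec G hdeg hadj hB hP (7 * l) S v (L + n) _ m hready hvS
    (by simp [v]) (by simp)).mono (by linarith) ?_)
  rintro r' m' ⟨hA, hkeep, hm'⟩
  have hkeep' : ∀ x, 1 ≤ x → x < 10 → r' x = r x := by
    intro x hx1 hx2
    rw [hkeep x hx1 hx2]
    repeat rw [Function.update_of_ne (by omega)]
  have g1 : r' 1 = r 1 := hkeep' 1 (by norm_num) (by norm_num)
  have g2 : r' 2 = 2 ^ l := (hkeep' 2 (by norm_num) (by norm_num)).trans h2
  have g3 : r' 3 = L := (hkeep' 3 (by norm_num) (by norm_num)).trans h3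
  have g4 : r' 4 = L + n := (hkeep' 4 (by norm_num) (by norm_num)).trans h4
  have g5 : r' 5 = 7 * l := (hkeep' 5 (by norm_num) (by norm_num)).trans h5
  have g6 : r' 6 = n := (hkeep' 6 (by norm_num) (by norm_num)).trans h6
  have g7 : r' 7 = n - i := (hkeep' 7 (by norm_num) (by norm_num)).trans h7
  have g8 : r' 8 = r 8 := hkeep' 8 (by norm_num) (by norm_num)
  have hmi : m' (L + i) = 0 := by
    rw [hm' _ (by omega)]
    simpa [v] using hmarks v
  obtain ⟨a1, a2, a3, -⟩ := hA
  have a3' := a3.trans (errBound_two_pow_le l)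
  have ha := (sinkRatio_le_two_thirds_pow G hdeg hvS).trans (two_thirds_pow_le (hdeg v))
  obtain ⟨s1, s2, s3, s4⟩ := mantissa_step hQ0 a1 a2 ha a3' h8 h8'
  have a4 : r' 0 ≤ 2 ^ l := by
    have hQ' : (0 : ℝ) < ((2 ^ l : ℤ) : ℝ) := by exact_mod_cast hQ0
    have : (r' 0 : ℝ) ≤ ((2 ^ l : ℤ) : ℝ) := by nlinarith
    exact_mod_cast this
  have hest' := PartialEstimate.succ G hdeg (v := v) hest s3 s4
  have hz0 : 0 ≤ r 8 * (2 ^ l - r' 0) := mul_nonneg (by omega) (by omega)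
  have hz1 : r 8 * (2 ^ l - r' 0) ≤ 2 * 2 ^ l * 2 ^ l :=
    mul_le_mul h8' (by omega) (by omega) (by omega)
  set Z := r 8 * (2 ^ l - r' 0) / 2 ^ l with hZ
  have hlay' : Layout adj off L (Function.update m' (L + i) 1) := by
    refine hlay.congr fun x hx => ?_
    rw [Function.update_of_ne (by omega), hm' x (by omega)]
  have hmarks' : ∀ u : Fin n, Function.update m' (L + i) 1 (L + (u : ℕ)) =
      if u.val < i + 1 then 1 else 0 := by
    intro u
    have hu := u.2
    by_cases hui : u.val = i
    · rw [hui, Function.update_self, if_pos (by omega)]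
    · rw [Function.update_of_ne (by omega), hm' _ (by omega), hmarks u]
      congr 1
      exact propext (by omega)
  refine triple_seq_arith i (by simp [Op.eval, g6, g7]) (abs_le.2 ⟨by omega, by omega⟩) ?_
  refine triple_seq_arith (L + i) (by simp [Op.eval, g3]) (abs_le.2 ⟨by omega, by omega⟩) ?_
  refine triple_seq_bump (L + i) 0 (by simp) (by simp) hmi (by simp)
    (abs_le.2 ⟨by omega, by omega⟩) (abs_le.2 ⟨by omega, by omega⟩) ?_
  refine triple_seq_arith (2 ^ l - r' 0) (by simp [Op.eval, g2])
    (abs_le.2 ⟨by omega, by omega⟩) ?_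
  refine triple_seq_arith (r 8 * (2 ^ l - r' 0)) (by simp [Op.eval, g8])
    (abs_le.2 ⟨by linarith, by linarith⟩) ?_
  refine triple_seq_arith Z (by simp [Op.eval, g2, hZ])
    (abs_le.2 ⟨by omega, by omega⟩) ?_
  refine triple_seq_const (abs_le.2 ⟨by omega, by omega⟩) ?_
  refine triple_seq_arith (n - (i + 1 : ℕ)) (by simp [Op.eval, g7]; ring)
    (abs_le.2 ⟨by omega, by omega⟩) ?_
  refine triple_seq_arith (2 ^ l - Z) (by simp [Op.eval, g2])
    (abs_le.2 ⟨by omega, by omega⟩) ?_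
  rw [zero_add]
  -- Renormalisation: a mantissa below Q is doubled and the exponent is lowered by 1.
  refine triple_ifPos (fun h => ?_) (fun h => ?_)
  · replace h : Z < 2 ^ l := by simpa using h
    refine triple_seq_arith (Z + Z) (by simp [Op.eval]) (abs_le.2 ⟨by omega, by omega⟩) ?_
    refine triple_seq_const (abs_le.2 ⟨by omega, by omega⟩) ?_
    refine triple_arith (r 1 - 1) (by simp [Op.eval, g1]) (abs_le.2 ⟨by omega, by omega⟩)
      (by linarith) ?_
    exact ⟨by simp only [Function.update_self]; exact abs_le.2 ⟨by omega, by omega⟩,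
      by simp [g2], by simp [g3], by simp [g4], by simp [g5], by simp [g6], by simp,
      by simp; omega, hlay', hmarks', by simpa using hest'.double⟩
  · replace h : 2 ^ l ≤ Z := by simpa using h
    refine triple_skip (by linarith) ?_
    exact ⟨by simp [g1]; exact abs_le.2 ⟨by omega, by omega⟩,
      by simp [g2], by simp [g3], by simp [g4], by simp [g5], by simp [g6], by simp,
      by simp; omega, hlay', hmarks', by simpa [g1] using hest'⟩

end Main

end WordRAM

/-! ### The whole run: parameters, time and word size. -/

namespace WordRAM

section Main

variable {n : ℕ} (G : SimpleGraph (Fin n)) [DecidableRel G.Adj] {adj : Fin n → List (Fin n)}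
  {W l : ℕ} {P : Program}

theorem listAddress_self_eq (hadj : IsAdjacencyLists G adj) :
    listAddress adj n = n + 4 + 2 * G.edgeFinset.card := by
  rw [listAddress_self, ← G.sum_degrees_eq_twice_card_edges]
  congr 1
  exact Finset.sum_congr rfl fun v _ => length_eq_degree G hadj v

theorem initial_mem_head (adj : Fin n → List (Fin n)) (p q : ℕ) :
    (initial (graphInput adj p q)).mem 0 = n ∧ (initial (graphInput adj p q)).mem 1 = p ∧
      (initial (graphInput adj p q)).mem 2 = q ∧
      (initial (graphInput adj p q)).mem (n + 3) = listAddress adj n := by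
  obtain ⟨h0, h1, h2⟩ := graphInput_head adj p q
  have h3 := graphInput_address adj p q le_rfl
  refine ⟨by simpa [initial] using h0, by simpa [initial] using h1, by simpa [initial] using h2, ?_⟩
  have h : (0 : ℤ) ≤ (n : ℤ) + 3 := by positivity
  have h' : ((n : ℤ) + 3).toNat = n + 3 := by omega
  simp only [initial, if_pos h, h']
  exact h3

theorem mainProc_spec (hdeg : ∀ v, 3 ≤ G.degree v) (hadj : IsAdjacencyLists G adj)
    (hP : P[1]? = some nodeProc) {p q : ℕ} (hp : 0 < p)
    (hl : ∀ i < l, 2 ^ i * p < 32 * n * q) (hl' : 32 * n * q ≤ 2 ^ l * p)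
    (hW1 : 2 * 2 ^ l * 2 ^ l ≤ W) (hW2 : 2 * n + 4 + 2 * G.edgeFinset.card + 28 * l ≤ W)
    (hW4 : 100 ≤ W) (hW5 : 64 * n * q ≤ W) (hpW : p ≤ W) (hqW : q ≤ W) (hnqW : n * q ≤ W) :
    Triple W P mainProc (fun _ => 0) (initial (graphInput adj p q)).mem
      (100 + 31 * l + n * (nodeTime (7 * l) + 61))
      fun r' _ => PartialEstimate G (2 ^ l) n (r' 0) (r' 1) := by
  have hLeq := listAddress_self_eq G hadj
  obtain ⟨i0, i1, i2, i3⟩ := initial_mem_head adj p q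
  have hlay := layout_graphInput adj p q
  have hmem0 := fun x => initial_mem_of_le adj p q (x := x)
  set m₀ := (initial (graphInput adj p q)).mem
  set e := G.edgeFinset.card
  set L := listAddress adj n
  have hD : (32 * n * q : ℕ) = 32 * (n * q) := by ring
  have hD' : (64 * n * q : ℕ) = 64 * (n * q) := by ring
  have hnqZ : ((n * q : ℕ) : ℤ) = (q : ℤ) * n := by push_cast; ring
  -- The lists have total length 2m, so the number of edges is read off from their end address.
  have hhalf : ((L : ℤ) - n - 4) / 2 = e := by omega
  unfold mainProc
  refine triple_seq 50 ?_
  refine triple_seq_const (by simp) ?_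
  refine triple_seq_load n (by simp [i0]) (abs_le.2 ⟨by omega, by omega⟩) ?_
  refine triple_seq_const (abs_le.2 ⟨by omega, by omega⟩) ?_
  refine triple_seq_load p (by simp [i1]) (abs_le.2 ⟨by omega, by omega⟩) ?_
  refine triple_seq_const (abs_le.2 ⟨by omega, by omega⟩) ?_
  refine triple_seq_load q (by simp [i2]) (abs_le.2 ⟨by omega, by omega⟩) ?_
  refine triple_seq_const (abs_le.2 ⟨by omega, by omega⟩) ?_
  refine triple_seq_arith (n + 3) (by simp [Op.eval]) (abs_le.2 ⟨by omega, by omega⟩) ?_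
  refine triple_seq_load L (by simp [i3]) (abs_le.2 ⟨by omega, by omega⟩) ?_
  refine triple_seq_arith (L - n) (by simp [Op.eval]) (abs_le.2 ⟨by omega, by omega⟩) ?_
  refine triple_seq_const (abs_le.2 ⟨by omega, by omega⟩) ?_
  refine triple_seq_arith (L - n - 4) (by simp [Op.eval]) (abs_le.2 ⟨by omega, by omega⟩) ?_
  refine triple_seq_const (abs_le.2 ⟨by omega, by omega⟩) ?_
  refine triple_seq_arith e (by simp [Op.eval, hhalf]) (abs_le.2 ⟨by omega, by omega⟩) ?_
  refine triple_seq_arith (L + n) (by simp [Op.eval]) (abs_le.2 ⟨by omega, by omega⟩) ?_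
  refine triple_seq_const (abs_le.2 ⟨by omega, by omega⟩) ?_
  refine triple_seq_arith ((n * q : ℕ) : ℤ) (by simp [Op.eval]; ring)
    (abs_le.2 ⟨by omega, by omega⟩) ?_
  refine triple_seq_arith ((32 * n * q : ℕ) : ℤ) (by simp [Op.eval]; ring)
    (abs_le.2 ⟨by omega, by omega⟩) ?_
  refine triple_seq_const (abs_le.2 ⟨by omega, by omega⟩) ?_
  refine triple_seq_const (by simp) ?_
  refine triple_seq_arith p (by simp [Op.eval]) (abs_le.2 ⟨by omega, by omega⟩) ?_
  refine triple_arith ((32 * n * q : ℕ) - p) (by simp [Op.eval])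
    (abs_le.2 ⟨by omega, by omega⟩) (by norm_num) ?_
  -- scaling
  refine triple_seq (1 + l * (30 + 1)) ((triple_while
    (ScaleInv L n p (32 * n * q : ℕ) e m₀) ?_ ?_ ?_).mono le_rfl ?_)
  · intro i hi r m hI
    have hpos : (0 : ℤ) < (32 * n * q : ℕ) - 2 ^ i * p := by
      have : ((2 ^ i * p : ℕ) : ℤ) < (32 * n * q : ℕ) := by exact_mod_cast hl i hi
      push_cast at this ⊢
      linarith
    refine ⟨by rw [hI.r22]; exact hpos, ?_⟩
    exact scaleBody_spec hI (by omega) (by omega) hpos (by omega) (by omega) (by omega)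
  · intro r m hI
    rw [hI.r22]
    have : ((32 * n * q : ℕ) : ℤ) ≤ (2 ^ l * p : ℕ) := by exact_mod_cast hl'
    push_cast at this ⊢
    linarith
  · exact ⟨rfl, by simp, by simp, by simp, by simp, by simp, by simp, by simp, by simp, by simp⟩
  rintro r m ⟨rfl, r1, r2, r3, r4, r5, r6, -, -, -⟩
  have hQ0 : (0 : ℤ) < 2 ^ l := by positivity
  have hW1' : (2 : ℤ) * 2 ^ l * 2 ^ l ≤ W := by exact_mod_cast hW1
  have hQW : (2 : ℤ) ^ l ≤ W := by nlinarith
  -- the vertices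
  refine triple_seq 5 ?_
  refine triple_seq_const (by simp) ?_
  refine triple_seq_arith n (by simp [Op.eval, r6]) (abs_le.2 ⟨by omega, by omega⟩) ?_
  refine triple_arith (2 ^ l) (by simp [Op.eval, r2]) (abs_le.2 ⟨by omega, by omega⟩)
    (by norm_num) ?_
  refine triple_seq (1 + n * (nodeTime (7 * l) + 60 + 1)) ((triple_while
    (VertexInv G adj (fun v => listAddress adj v) L l) ?_ ?_ ?_).mono le_rfl ?_)
  · intro i hi r m hI
    have := hI.r7
    exact ⟨by omega, vertexBody_spec G hdeg hadj hP hI hi (by omega) hW1 (by omega)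
      (by omega) hW4⟩
  · intro r m hI
    have := hI.r7
    omega
  · refine ⟨?_, by simp [r2], by simp [r3], by simp [r4], by simp [r5], by simp [r6], by simp,
      by simp, hlay, fun u => by rw [if_neg (by omega)]; exact hmem0 _ (by omega), ?_⟩
    · simp only [ne_eq, OfNat.one_ne_ofNat, not_false_eq_true, Function.update_of_ne, r1]
      exact abs_le.2 ⟨by omega, by omega⟩
    · simpa [r1] using partialEstimate_zero G l
  rintro r' m' hI
  obtain ⟨h8, h8'⟩ := hI.r8
  have hQW2 : (2 : ℤ) * 2 ^ l ≤ W := by nlinarith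
  refine triple_seq_const (by simp) ?_
  refine triple_arith (r' 8) (by simp [Op.eval]) (abs_le.2 ⟨by omega, by omega⟩)
    (by linarith) ?_
  simpa using hI.est

/-- Rests on (3/2)^7 < 2^5, which is where the exponent 5 of Q comes from. -/
theorem nodeTime_le (l : ℕ) : nodeTime (7 * l) ≤ 1000 * (2 ^ l : ℝ) ^ 5 := by
  have h : ((3 / 2 : ℝ) ^ 7) ^ l ≤ ((2 : ℝ) ^ 5) ^ l := pow_le_pow_left₀ (by positivity) (by norm_num) l
  rw [← pow_mul, ← pow_mul, mul_comm 5 l, pow_mul 2 l 5] at h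
  unfold nodeTime
  linarith

/-- The word bound suffices. -/
theorem word_bounds {n m p q l : ℕ} (hn : 1 ≤ n) (hp : 0 < p) (hq : 0 < q) (hm : 2 * m ≤ n * n)
    (hQ : 2 ^ l ≤ 64 * n * q) :
    2 * 2 ^ l * 2 ^ l ≤ (n + p + q) ^ 13 ∧ 2 * n + 4 + 2 * m + 28 * l ≤ (n + p + q) ^ 13 ∧
      100 ≤ (n + p + q) ^ 13 ∧ 64 * n * q ≤ (n + p + q) ^ 13 ∧ p ≤ (n + p + q) ^ 13 ∧
      q ≤ (n + p + q) ^ 13 ∧ n * q ≤ (n + p + q) ^ 13 := by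
  set s := n + p + q with hs
  have hs3 : 3 ≤ s := by omega
  have h9 : 3 ^ 9 ≤ s ^ 9 := Nat.pow_le_pow_left hs3 9
  have h11 : 3 ^ 11 ≤ s ^ 11 := Nat.pow_le_pow_left hs3 11
  -- Surplus powers of s ≥ 3 absorb the constants; in particular 2 * 64² = 8192 < 3^9.
  have e1 : s ^ 13 = s ^ 9 * (s ^ 2 * s ^ 2) := by ring
  have e2 : s ^ 13 = s ^ 11 * s ^ 2 := by ring
  have b1 : 19683 * (s ^ 2 * s ^ 2) ≤ s ^ 13 := by
    rw [e1]
    exact Nat.mul_le_mul_right _ (by simpa using h9)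
  have b2 : 177147 * s ^ 2 ≤ s ^ 13 := by
    rw [e2]
    exact Nat.mul_le_mul_right _ (by simpa using h11)
  have hnq : n * q ≤ s ^ 2 := by
    rw [sq]
    exact Nat.mul_le_mul (by omega) (by omega)
  have hnn : n * n ≤ s ^ 2 := by
    rw [sq]
    exact Nat.mul_le_mul (by omega) (by omega)
  have hss : s ≤ s ^ 2 := Nat.le_self_pow (by norm_num) s
  have hQ2 : 2 ^ l ≤ 64 * s ^ 2 := by
    rw [mul_assoc] at hQ
    omega
  have hl : l < 2 ^ l := Nat.lt_two_pow_self
  have hQQ : 2 ^ l * 2 ^ l ≤ 64 * s ^ 2 * (64 * s ^ 2) := Nat.mul_le_mul hQ2 hQ2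
  refine ⟨?_, by omega, by omega, ?_, by omega, by omega, by omega⟩
  · nlinarith
  · rw [mul_assoc]
    omega

end Main

end WordRAM

open WordRAM in
theorem mainTheorem1 :
    ∃ (P : WordRAM.Program) (c : ℕ) (C : ℝ),
      ∀ (n : ℕ) (G : SimpleGraph (Fin n)) [DecidableRel G.Adj] (adj : Fin n → List (Fin n))
        (p q : ℕ) (ε : ℝ),
        3 ≤ G.minDegree → IsAdjacencyLists G adj → 0 < p → 0 < q → ε = (p : ℝ) / (q : ℝ) →
        ∃ (t : ℕ) (a b : ℤ),
          WordRAM.HaltsWith ((n + p + q) ^ c) P (graphInput adj p q) t a b ∧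
          (t : ℝ) ≤ C * (n : ℝ) * (max 1 ((G.edgeFinset.card : ℝ) / ε)) ^ 7 ∧
          Real.exp (-ε) * (sfo G : ℝ) ≤ (a : ℝ) * (2 : ℝ) ^ b ∧
          (a : ℝ) * (2 : ℝ) ^ b ≤ Real.exp ε * (sfo G : ℝ) := by
  refine ⟨sinkFreeProgram, 13, 2000 * 64 ^ 5, ?_⟩
  intro n G _ adj p q ε hmin hadj hp hq hε
  have hdeg : ∀ v, 3 ≤ G.degree v := fun v => hmin.trans (G.minDegree_le_degree v)
  have hn : 1 ≤ n := by
    -- The empty graph has minimum degree 0 by convention.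
    rcases Nat.eq_zero_or_pos n with rfl | h
    · rw [SimpleGraph.minDegree_of_subsingleton] at hmin
      omega
    · exact h
  have hsum := G.sum_degrees_eq_twice_card_edges
  have hm1 : n * 3 ≤ 2 * G.edgeFinset.card := by
    rw [← hsum]
    simpa using Finset.card_nsmul_le_sum Finset.univ _ 3 fun v _ => hdeg v
  have hm2 : 2 * G.edgeFinset.card ≤ n * n := by
    rw [← hsum]
    simpa using Finset.sum_le_card_nsmul Finset.univ _ n fun v _ =>
      (G.degree_lt_card_verts v).le.trans_eq (Fintype.card_fin n)
  have hex : ∃ l, 32 * n * q ≤ 2 ^ l * p :=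
    ⟨32 * n * q, Nat.lt_two_pow_self.le.trans (Nat.le_mul_of_pos_right _ hp)⟩
  obtain ⟨l, hl', hl⟩ : ∃ l, 32 * n * q ≤ 2 ^ l * p ∧ ∀ i < l, 2 ^ i * p < 32 * n * q :=
    ⟨Nat.find hex, Nat.find_spec hex, fun i hi => not_le.1 (Nat.find_min hex hi)⟩
  have hpR : (0 : ℝ) < p := by exact_mod_cast hp
  have hqR : (0 : ℝ) < q := by exact_mod_cast hq
  have hε0 : 0 < ε := by rw [hε]; positivity
  have hpε : (p : ℝ) = ε * q := by rw [hε]; field_simp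
  have hnR : (1 : ℝ) ≤ n := by exact_mod_cast hn
  set M := max 1 ((G.edgeFinset.card : ℝ) / ε) with hM
  have hM1 : 1 ≤ M := le_max_left _ _
  have hnq : 1 ≤ n * q := Nat.mul_pos hn hq
  -- By minimality of l, the scaling factor overshoots 32nq/p by less than a factor 2, unless it is
  -- 1.
  have hQ : l = 0 ∨ 2 ^ l * p ≤ 64 * n * q := by
    rcases l with _ | l
    · exact Or.inl rfl
    · right
      have := hl l (by omega)
      have e1 : 2 ^ (l + 1) * p = 2 * (2 ^ l * p) := by ring
      have e2 : 64 * n * q = 2 * (32 * n * q) := by ring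
      omega
  have hQ1 : 2 ^ l ≤ 64 * n * q := by
    rcases hQ with rfl | h
    · rw [mul_assoc]
      omega
    · exact (Nat.le_mul_of_pos_right _ hp).trans h
  have hQM : (2 : ℝ) ^ l ≤ 64 * M := by
    rcases hQ with rfl | h
    · rw [pow_zero]
      linarith
    · have h1 : (2 : ℝ) ^ l * p ≤ 64 * n * q := by exact_mod_cast h
      have h2 : (2 : ℝ) ^ l * ε ≤ 64 * n := by
        rw [hpε] at h1
        refine le_of_mul_le_mul_right ?_ hqR
        linarith
      -- Minimum degree 3 gives n ≤ 2m/3, so n/ε may be replaced by m/ε.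
      have h3 : (n : ℝ) ≤ G.edgeFinset.card := by
        have : n ≤ G.edgeFinset.card := by omega
        exact_mod_cast this
      have h4 : (2 : ℝ) ^ l ≤ 64 * ((G.edgeFinset.card : ℝ) / ε) := by
        rw [mul_div_assoc', le_div_iff₀ hε0]
        linarith
      exact h4.trans (mul_le_mul_of_nonneg_left (le_max_right _ _) (by norm_num))
  obtain ⟨w1, w2, w3, w4, w5, w6, w7⟩ := word_bounds hn hp hq hm2 hQ1
  obtain ⟨t, ht, r, m, hest, hrun⟩ := triple_call (i := 0) (P := sinkFreeProgram) (c := mainProc)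
    rfl ((mainProc_spec G hdeg hadj (P := sinkFreeProgram) rfl hp hl hl' w1 w2 w3 w4 w5 w6
      w7).mono (b' := 101 + 31 * l + n * (nodeTime (7 * l) + 61) - 1) (by linarith)
        fun _ _ h => h)
  refine ⟨t, r 0, r 1, ⟨⟨[], r, m⟩, hrun [], rfl, rfl, rfl⟩, ?_, hest.final G (by positivity) ?_⟩
  · refine ht.trans ?_
    have hQ1R : (1 : ℝ) ≤ 2 ^ l := one_le_pow₀ (by norm_num)
    have hlQ : (l : ℝ) ≤ 2 ^ l := by exact_mod_cast Nat.lt_two_pow_self.le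
    have hQ5 : (2 : ℝ) ^ l ≤ (2 ^ l) ^ 5 := le_self_pow₀ hQ1R (by norm_num)
    have hnode := nodeTime_le l
    have h5 : ((2 : ℝ) ^ l) ^ 5 ≤ 64 ^ 5 * M ^ 7 := by
      calc ((2 : ℝ) ^ l) ^ 5 ≤ (64 * M) ^ 5 := pow_le_pow_left₀ (by positivity) hQM 5
        _ = 64 ^ 5 * M ^ 5 := mul_pow _ _ _
        -- The algorithm needs only exponent 5; M ≥ 1 allows the larger exponent of the claim.
        _ ≤ 64 ^ 5 * M ^ 7 := by
          gcongr
          norm_num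
    set X := ((2 : ℝ) ^ l) ^ 5
    have hX : 1 ≤ X := hQ1R.trans hQ5
    calc 101 + 31 * (l : ℝ) + n * (nodeTime (7 * l) + 61)
        ≤ 132 * X + n * (1061 * X) := by
          have : (n : ℝ) * (nodeTime (7 * l) + 61) ≤ n * (1061 * X) :=
            mul_le_mul_of_nonneg_left (by linarith) (by linarith)
          linarith
      _ ≤ 2000 * n * X := by nlinarith
      _ ≤ 2000 * n * (64 ^ 5 * M ^ 7) := by gcongr
      _ = 2000 * 64 ^ 5 * n * M ^ 7 := by ring
  · have h1 : (32 : ℝ) * n * q ≤ 2 ^ l * p := by exact_mod_cast hl'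
    rw [hpε] at h1
    push_cast
    refine le_of_mul_le_mul_right ?_ hqR
    linarith
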